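/- Let $M$ be a smooth (Hausdorff) manifold of dimension $2n+1$, $n\ge 1$, and let $\eta$ be a contact form on $M$, i.e. a smooth $1$-form such that $\eta\wedge(d\eta)^n$ vanishes nowhere, where $d\eta(X,Y)=X\cdot\eta(Y)-Y\cdot\eta(X)-\eta([X,Y])$. Let $\sharp_\eta:T^*M\to TM$ be the inverse of the isomorphism $\flat_\eta(X)=-d\eta(X,\cdot)+\eta(X)\eta$. The Jacobi structure $(\pi,\xi)$ associated with $\eta$ is $$\pi(\alpha,\beta)=d\eta(\sharp_\eta(\alpha),\sharp_\eta(\beta)),\qquad \xi=\sharp_\eta(\eta)\quad\text{(the Reeb field)}.$$ Let $g$ be a smooth Riemannian metric on $M$ such that $(\eta,g)$ is a Riemannian contact structure, with associated almost contact structure $(\Phi,\xi,\eta,g)$: $\Phi$ is a smooth field of endomorphisms of $TM$ and, for all $X,Y$, $$\Phi^2=-\mathrm{Id}+\eta\otimes\xi,\quad \eta(\xi)=1,\quad g(\Phi X,\Phi Y)=g(X,Y)-\eta(X)\eta(Y),\quad g(X,\Phi Y)=d\eta(X,Y).$$ For any triple $(\pi,\xi,g)$ consisting of a bivector field, a vector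 field and a metric, let $\flat_g(X)=g(X,\cdot)$, $\sharp_g=\flat_g^{-1}$, $g^*(\alpha,\beta)=g(\sharp_g\alpha,\sharp_g\beta)$; define $\sharp_\pi$ by $\beta(\sharp_\pi(\alpha))=\pi(\alpha,\beta)$ and put $\sharp_{\pi,\xi}(\alpha)=\sharp_\pi(\alpha)+\alpha(\xi)\xi$; define $J$ and $J^*$ by $g(J\sharp_g\alpha,\sharp_g\beta)=\pi(\alpha,\beta)=g^*(J^*\alpha,\beta)$; put $\lambda=g(\xi,\xi)\flat_g(\xi)-\flat_g(J\xi)$ and $$[\alpha,\beta]_\pi=\mathcal L_{\sharp_\pi(\alpha)}\beta-\mathcal L_{\sharp_\pi(\beta)}\alpha-d(\pi(\alpha,\beta)),$$ $$[\alpha,\beta]^g_{\pi,\xi}=[\alpha,\beta]_\pi+\alpha(\xi)(\mathcal L_\xi\beta-\beta)-\beta(\xi)(\mathcal L_\xi\alpha-\alpha)-\pi(\alpha,\beta)\lambda.$$ The contravariant Levi-Civita derivative $\mathcal D$ of $(\pi,\xi,g)$ is the derivative on $1$-forms characterised by $$2g^*(\mathcal D_\alpha\beta,\gamma)=\sharp_{\pi,\xi}(\alpha)\cdot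 g^*(\beta,\gamma)+\sharp_{\pi,\xi}(\beta)\cdot g^*(\alpha,\gamma)-\sharp_{\pi,\xi}(\gamma)\cdot g^*(\alpha,\beta)-g^*([\beta,\gamma]^g_{\pi,\xi},\alpha)-g^*([\alpha,\gamma]^g_{\pi,\xi},\beta)+g^*([\alpha,\beta]^g_{\pi,\xi},\gamma),$$ and $\mathcal D\pi(\alpha,\beta,\gamma)=\sharp_{\pi,\xi}(\alpha)\cdot\pi(\beta,\gamma)-\pi(\mathcal D_\alpha\beta,\gamma)-\pi(\beta,\mathcal D_\alpha\gamma)$. The triple $(\pi,\xi,g)$ is called compatible if, for all smooth $1$-forms $\alpha,\beta,\gamma$, $$\mathcal D\pi(\alpha,\beta,\gamma)=\tfrac12\big(\gamma(\xi)\pi(\alpha,\beta)-\beta(\xi)\pi(\alpha,\gamma)-(J^*\gamma)(\xi)\,g^*(\alpha,\beta)+(J^*\beta)(\xi)\,g^*(\alpha,\gamma)\big).$$ A Riemannian almost contact structure $(\Phi,\xi,\eta,g)$ is called $\tfrac12$-Kenmotsu if, with $\nabla$ the Levi-Civita connection of $g$, for all smooth vector fields $X,Y$, $$(\nabla_X\Phi)(Y)=\tfrac12\big(g(\Phi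 X,Y)\xi-\eta(Y)\Phi X\big).$$ Theorem. For a Riemannian contact structure $(\eta,g)$ with associated almost contact structure $(\Phi,\xi,\eta,g)$ and associated Jacobi structure $(\pi,\xi)$ as above, the triple $(\pi,\xi,g)$ is compatible if and only if $(M,\Phi,\xi,\eta,g)$ is $\tfrac12$-Kenmotsu. -/

import Mathlib

open scoped Manifold ContDiff Bundle

noncomputable section

namespace JacobiRiemannian

/-! ### Fields on a smooth manifold modelled on `ℝ^d` -/

section Fields

variable {d : ℕ} {M : Type*} [TopologicalSpace M]
  [ChartedSpace (EuclideanSpace ℝ (Fin d)) M]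

/-- The cotangent space `T*_x M`. -/
abbrev Cotangent (d : ℕ) {M : Type*} [TopologicalSpace M]
    [ChartedSpace (EuclideanSpace ℝ (Fin d)) M] (x : M) : Type :=
  TangentSpace (𝓡 d) x →L[ℝ] ℝ

/-- Fields of tangent vectors (no regularity imposed). -/
abbrev VField (d : ℕ) (M : Type*) [TopologicalSpace M]
    [ChartedSpace (EuclideanSpace ℝ (Fin d)) M] : Type _ :=
  ∀ x : M, TangentSpace (𝓡 d) x

/-- Fields of covectors (no regularity imposed). -/
abbrev OneForm (d : ℕ) (M : Type*) [TopologicalSpace M]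
    [ChartedSpace (EuclideanSpace ℝ (Fin d)) M] : Type _ :=
  ∀ x : M, Cotangent d x

/-- Fields of endomorphisms of the tangent bundle (no regularity imposed). -/
abbrev EndField (d : ℕ) (M : Type*) [TopologicalSpace M]
    [ChartedSpace (EuclideanSpace ℝ (Fin d)) M] : Type _ :=
  ∀ x : M, TangentSpace (𝓡 d) x →L[ℝ] TangentSpace (𝓡 d) x

/-- Fields of bilinear forms on the cotangent bundle; a bivector field is seen as such a field. -/
abbrev BivField (d : ℕ) (M : Type*) [TopologicalSpace M]
    [ChartedSpace (EuclideanSpace ℝ (Fin d)) M] : Type _ :=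
  ∀ x : M, Cotangent d x →ₗ[ℝ] Cotangent d x →ₗ[ℝ] ℝ

/-- Smooth Riemannian metrics on `M`. -/
abbrev Metric (d : ℕ) (M : Type*) [TopologicalSpace M]
    [ChartedSpace (EuclideanSpace ℝ (Fin d)) M] [IsManifold (𝓡 d) ∞ M] : Type _ :=
  Bundle.ContMDiffRiemannianMetric (𝓡 d) ∞ (EuclideanSpace ℝ (Fin d))
    (fun x : M => TangentSpace (𝓡 d) x)

variable [IsManifold (𝓡 d) ∞ M]

/-- Smooth vector fields, `X ∈ 𝔛(M)`. -/
def SmoothVField (X : VField d M) : Prop :=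
  ContMDiff (𝓡 d) ((𝓡 d).prod 𝓘(ℝ, EuclideanSpace ℝ (Fin d))) ∞
    (fun x => Bundle.TotalSpace.mk' (EuclideanSpace ℝ (Fin d)) x (X x))

/-- Smooth differential `1`-forms, `α ∈ Ω¹(M)`. -/
def SmoothForm (α : OneForm d M) : Prop :=
  ContMDiff (𝓡 d) ((𝓡 d).prod 𝓘(ℝ, EuclideanSpace ℝ (Fin d) →L[ℝ] ℝ)) ∞
    (fun x => Bundle.TotalSpace.mk' (EuclideanSpace ℝ (Fin d) →L[ℝ] ℝ)
      (E := fun x : M => TangentSpace (𝓡 d) x →L[ℝ] ℝ) x (α x))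

/-- Smooth fields of endomorphisms of `TM`. -/
def SmoothEnd (Φ : EndField d M) : Prop :=
  ContMDiff (𝓡 d) ((𝓡 d).prod
      𝓘(ℝ, EuclideanSpace ℝ (Fin d) →L[ℝ] EuclideanSpace ℝ (Fin d))) ∞
    (fun x => Bundle.TotalSpace.mk' (EuclideanSpace ℝ (Fin d) →L[ℝ] EuclideanSpace ℝ (Fin d))
      (E := fun x : M => TangentSpace (𝓡 d) x →L[ℝ] TangentSpace (𝓡 d) x) x (Φ x))

/-- Vector fields that are differentiable at the point `x`. -/
def DiffVFieldAt (X : VField d M) (x : M) : Prop :=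
  MDifferentiableAt (𝓡 d) ((𝓡 d).prod 𝓘(ℝ, EuclideanSpace ℝ (Fin d)))
    (fun y => Bundle.TotalSpace.mk' (EuclideanSpace ℝ (Fin d)) y (X y)) x

/-- `1`-forms that are differentiable at the point `x`. -/
def DiffFormAt (α : OneForm d M) (x : M) : Prop :=
  MDifferentiableAt (𝓡 d) ((𝓡 d).prod 𝓘(ℝ, EuclideanSpace ℝ (Fin d) →L[ℝ] ℝ))
    (fun y => Bundle.TotalSpace.mk' (EuclideanSpace ℝ (Fin d) →L[ℝ] ℝ)
      (E := fun y : M => TangentSpace (𝓡 d) y →L[ℝ] ℝ) y (α y)) x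

end Fields

/-! ### Differential calculus of `1`-forms -/

section Calculus

variable {d : ℕ} {M : Type*} [TopologicalSpace M]
  [ChartedSpace (EuclideanSpace ℝ (Fin d)) M]

/-- The differential `df` of a function at `x`, so that `dfun f x (X x)` is `X · f` at `x`. -/
def dfun (f : M → ℝ) : OneForm d M := fun x => mvfderiv (𝓡 d) f x

/-- The expression of a `1`-form in the preferred chart at `x₀`: its pullback by the inverse
chart. -/
def chartForm (β : OneForm d M) (x₀ : M) (e : EuclideanSpace ℝ (Fin d)) :
    EuclideanSpace ℝ (Fin d) →L[ℝ] ℝ :=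
  (β ((extChartAt (𝓡 d) x₀).symm e)).comp
    (mfderiv 𝓘(ℝ, EuclideanSpace ℝ (Fin d)) (𝓡 d) (extChartAt (𝓡 d) x₀).symm e)

/-- The exterior derivative `dβ` of a `1`-form, computed in the preferred chart at `x`, with the
normalisation `dβ(X, Y) = X·β(Y) - Y·β(X) - β([X, Y])`. -/
def dform (β : OneForm d M) (x : M) :
    TangentSpace (𝓡 d) x →L[ℝ] TangentSpace (𝓡 d) x →L[ℝ] ℝ :=
  let A : EuclideanSpace ℝ (Fin d) →L[ℝ] EuclideanSpace ℝ (Fin d) →L[ℝ] ℝ :=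
    fderiv ℝ (chartForm β x) (extChartAt (𝓡 d) x x)
  let T : EuclideanSpace ℝ (Fin d) →L[ℝ] EuclideanSpace ℝ (Fin d) :=
    mfderiv (𝓡 d) 𝓘(ℝ, EuclideanSpace ℝ (Fin d)) (extChartAt (𝓡 d) x) x
  (A - A.flip).bilinearComp T T

/-- The Lie derivative `L_X β = i_X dβ + d(β(X))` of a `1`-form. -/
def lieForm (X : VField d M) (β : OneForm d M) : OneForm d M :=
  fun x => dform β x (X x) + dfun (fun y => β y (X y)) x

end Calculus

/-! ### The triple `(π, ξ, g)` -/

section Triple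

variable {d : ℕ} {M : Type*} [TopologicalSpace M]
  [ChartedSpace (EuclideanSpace ℝ (Fin d)) M]

/-- Finite-dimensionality of the tangent spaces. -/
instance tangentFinite (x : M) : FiniteDimensional ℝ (TangentSpace (𝓡 d) x) :=
  inferInstanceAs (FiniteDimensional ℝ (EuclideanSpace ℝ (Fin d)))

/-- The tangent spaces are Hausdorff. -/
instance tangentT2 (x : M) : T2Space (TangentSpace (𝓡 d) x) :=
  inferInstanceAs (T2Space (EuclideanSpace ℝ (Fin d)))

/-- The map `♯_π : T*M → TM`, `β(♯_π(α)) = π(α, β)` (see `apply_sharpPi`). -/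
def sharpPi (P : BivField d M) (x : M) (α : Cotangent d x) : TangentSpace (𝓡 d) x :=
  (Module.evalEquiv ℝ (TangentSpace (𝓡 d) x)).symm
    ((P x α).comp (LinearMap.toContinuousLinearMap
      (E := TangentSpace (𝓡 d) x) (F' := ℝ) (𝕜 := ℝ)).toLinearMap)

theorem apply_sharpPi (P : BivField d M) (x : M) (α β : Cotangent d x) :
    β (sharpPi P x α) = P x α β := by
  have := Module.apply_evalEquiv_symm_apply (R := ℝ) (M := TangentSpace (𝓡 d) x)
    (β : TangentSpace (𝓡 d) x →ₗ[ℝ] ℝ)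
    ((P x α).comp (LinearMap.toContinuousLinearMap
      (E := TangentSpace (𝓡 d) x) (F' := ℝ) (𝕜 := ℝ)).toLinearMap)
  exact this

/-- The anchor `♯_{π,ξ}(α) = ♯_π(α) + α(ξ) ξ`. -/
def anchor (P : BivField d M) (ξ : VField d M) (x : M) (α : Cotangent d x) :
    TangentSpace (𝓡 d) x :=
  sharpPi P x α + α (ξ x) • ξ x

/-- The Koszul bracket
`[α, β]_π = L_{♯_π(α)} β - L_{♯_π(β)} α - d(π(α, β))`. -/
def koszulBracket (P : BivField d M) (α β : OneForm d M) : OneForm d M := fun x =>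
  lieForm (fun y => sharpPi P y (α y)) β x - lieForm (fun y => sharpPi P y (β y)) α x
    - dfun (fun y => P y (α y) (β y)) x

/-- The bracket
`[α, β]_{π,ξ}^lam = [α, β]_π + α(ξ) (L_ξ β - β) - β(ξ) (L_ξ α - α) - π(α, β) lam`. -/
def jacobiBracket (P : BivField d M) (ξ : VField d M) (lam : OneForm d M)
    (α β : OneForm d M) : OneForm d M := fun x =>
  koszulBracket P α β x + α x (ξ x) • (lieForm ξ β x - β x)
    - β x (ξ x) • (lieForm ξ α x - α x) - P x (α x) (β x) • lam x

variable [IsManifold (𝓡 d) ∞ M]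

/-- The musical isomorphism `♭_g(v) = g(v, ·)`. -/
def flat (g : Metric d M) (x : M) :
    TangentSpace (𝓡 d) x →L[ℝ] (TangentSpace (𝓡 d) x →L[ℝ] ℝ) := g.inner x

/-- The musical isomorphism `♯_g`, inverse of `♭_g`. -/
def sharp (g : Metric d M) (x : M) :
    (TangentSpace (𝓡 d) x →L[ℝ] ℝ) →L[ℝ] TangentSpace (𝓡 d) x := (flat g x).inverse

/-- The cometric `g*(α, β) = g(♯_g(α), ♯_g(β))`. -/
def cometric (g : Metric d M) (x : M) (α β : Cotangent d x) : ℝ :=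
  g.inner x (sharp g x α) (sharp g x β)

/-- The endomorphism `J` of `TM` with `g(J ♯_g(α), ♯_g(β)) = π(α, β)` (see `inner_J`). -/
def J (P : BivField d M) (g : Metric d M) (x : M) (v : TangentSpace (𝓡 d) x) :
    TangentSpace (𝓡 d) x := sharpPi P x (flat g x v)

/-- The endomorphism `J*` of `T*M` with `g*(J* α, β) = π(α, β)` (see `cometric_Jstar`). -/
def Jstar (P : BivField d M) (g : Metric d M) (x : M) (α : Cotangent d x) : Cotangent d x :=
  flat g x (sharpPi P x α)

/-- The `1`-form `λ = g(ξ, ξ) ♭_g(ξ) - ♭_g(J ξ)`. -/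
def lamForm (P : BivField d M) (ξ : VField d M) (g : Metric d M) : OneForm d M := fun x =>
  g.inner x (ξ x) (ξ x) • flat g x (ξ x) - flat g x (J P g x (ξ x))

/-- The bracket `[·,·]_{π,ξ}^g`. -/
def metricBracket (P : BivField d M) (ξ : VField d M) (g : Metric d M)
    (α β : OneForm d M) : OneForm d M :=
  jacobiBracket P ξ (lamForm P ξ g) α β

/-- The right-hand side of the Koszul formula for the contravariant derivative. -/
def contraKoszul (P : BivField d M) (ξ : VField d M) (g : Metric d M)
    (α β γ : OneForm d M) (x : M) : ℝ :=
  dfun (fun y => cometric g y (β y) (γ y)) x (anchor P ξ x (α x))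
    + dfun (fun y => cometric g y (α y) (γ y)) x (anchor P ξ x (β x))
    - dfun (fun y => cometric g y (α y) (β y)) x (anchor P ξ x (γ x))
    - cometric g x (metricBracket P ξ g β γ x) (α x)
    - cometric g x (metricBracket P ξ g α γ x) (β x)
    + cometric g x (metricBracket P ξ g α β x) (γ x)

/-- The contravariant Levi-Civita derivative `D_α β` of `(π, ξ, g)`: its value at `x` is the
covector characterised by `2 g*(D_α β, γ) = contraKoszul α β γ` for all `γ`. -/
def contraDeriv (P : BivField d M) (ξ : VField d M) (g : Metric d M)
    (α β : OneForm d M) : OneForm d M := fun x =>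
  Classical.epsilon fun δ : Cotangent d x =>
    ∀ γ : OneForm d M, DiffFormAt γ x →
      2 * cometric g x δ (γ x) = contraKoszul P ξ g α β γ x

/-- The contravariant derivative of `π`:
`(Dπ)(α, β, γ) = ♯_{π,ξ}(α)·π(β, γ) - π(D_α β, γ) - π(β, D_α γ)`. -/
def contraDerivPi (P : BivField d M) (ξ : VField d M) (g : Metric d M)
    (α β γ : OneForm d M) (x : M) : ℝ :=
  dfun (fun y => P y (β y) (γ y)) x (anchor P ξ x (α x))
    - P x (contraDeriv P ξ g α β x) (γ x) - P x (β x) (contraDeriv P ξ g α γ x)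

/-- Compatibility of the triple `(π, ξ, g)`:
`Dπ(α, β, γ) = ½ (γ(ξ) π(α, β) - β(ξ) π(α, γ) - J*γ(ξ) g*(α, β) + J*β(ξ) g*(α, γ))`. -/
def Compatible (P : BivField d M) (ξ : VField d M) (g : Metric d M) : Prop :=
  ∀ α β γ : OneForm d M, SmoothForm α → SmoothForm β → SmoothForm γ → ∀ x : M,
    contraDerivPi P ξ g α β γ x =
      (1 / 2 : ℝ) * (γ x (ξ x) * P x (α x) (β x) - β x (ξ x) * P x (α x) (γ x)
        - Jstar P g x (γ x) (ξ x) * cometric g x (α x) (β x)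
        + Jstar P g x (β x) (ξ x) * cometric g x (α x) (γ x))

/-! ### The (covariant) Levi-Civita connection -/

/-- The right-hand side of the Koszul formula for the Levi-Civita connection. -/
def leviCivitaKoszul (g : Metric d M) (X Y Z : VField d M) (x : M) : ℝ :=
  dfun (fun y => g.inner y (Y y) (Z y)) x (X x)
    + dfun (fun y => g.inner y (X y) (Z y)) x (Y x)
    - dfun (fun y => g.inner y (X y) (Y y)) x (Z x)
    - g.inner x (VectorField.mlieBracket (𝓡 d) Y Z x) (X x)
    - g.inner x (VectorField.mlieBracket (𝓡 d) X Z x) (Y x)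
    + g.inner x (VectorField.mlieBracket (𝓡 d) X Y x) (Z x)

/-- The Levi-Civita connection `∇_X Y` of `g`: its value at `x` is the tangent vector
characterised by `2 g(∇_X Y, Z) = leviCivitaKoszul X Y Z` for all `Z`. -/
def leviCivita (g : Metric d M) (X Y : VField d M) : VField d M := fun x =>
  Classical.epsilon fun u : TangentSpace (𝓡 d) x =>
    ∀ Z : VField d M, DiffVFieldAt Z x →
      2 * g.inner x u (Z x) = leviCivitaKoszul g X Y Z x

/-! ### Almost contact structures -/

/-- `(Φ, ξ, η, g)` is a Riemannian almost contact structure: `Φ² = -Id + η ⊗ ξ`, `η(ξ) = 1` and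
`g(Φ X, Φ Y) = g(X, Y) - η(X) η(Y)`. -/
structure IsRiemannianAlmostContact (Φ : EndField d M) (ξ : VField d M) (η : OneForm d M)
    (g : Metric d M) : Prop where
  smooth_Φ : SmoothEnd Φ
  smooth_ξ : SmoothVField ξ
  smooth_η : SmoothForm η
  Φ_sq : ∀ (x : M) (v : TangentSpace (𝓡 d) x), Φ x (Φ x v) = -v + η x v • ξ x
  η_ξ : ∀ x : M, η x (ξ x) = 1
  associated : ∀ (x : M) (v w : TangentSpace (𝓡 d) x),
    g.inner x (Φ x v) (Φ x w) = g.inner x v w - η x v * η x w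

/-- The `½`-Kenmotsu condition `(∇_X Φ)(Y) = ½ (g(Φ X, Y) ξ - η(Y) Φ X)`, where
`(∇_X Φ)(Y) = ∇_X (Φ Y) - Φ (∇_X Y)`, for a Riemannian almost contact structure. -/
structure IsHalfKenmotsu (Φ : EndField d M) (ξ : VField d M) (η : OneForm d M)
    (g : Metric d M) : Prop extends IsRiemannianAlmostContact Φ ξ η g where
  kenmotsu : ∀ X Y : VField d M, SmoothVField X → SmoothVField Y → ∀ x : M,
    leviCivita g X (fun y => Φ y (Y y)) x - Φ x (leviCivita g X Y x) =
      (1 / 2 : ℝ) • (g.inner x (Φ x (X x)) (Y x) • ξ x - η x (Y x) • Φ x (X x))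

/-! ### Verification of the defining relations of `♯_g`, `J`, `J*` -/

theorem flat_isInvertible (g : Metric d M) (x : M) : (flat g x).IsInvertible := by
  have hinj : Function.Injective (flat g x) := by
    rw [injective_iff_map_eq_zero]
    intro v hv
    by_contra hne
    have h1 := g.pos x v hne
    have h2 : g.inner x v v = 0 := by
      change flat g x v v = 0
      rw [hv]; rfl
    exact absurd h2 h1.ne'
  have hdim : Module.finrank ℝ (TangentSpace (𝓡 d) x) =
      Module.finrank ℝ (Cotangent d x) := by
    rw [← LinearEquiv.finrank_eq (LinearMap.toContinuousLinearMap
      (E := TangentSpace (𝓡 d) x) (F' := ℝ) (𝕜 := ℝ))]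
    exact (Subspace.dual_finrank_eq (K := ℝ) (V := TangentSpace (𝓡 d) x)).symm
  have : FiniteDimensional ℝ (Cotangent d x) := Module.Finite.equiv
    (LinearMap.toContinuousLinearMap (E := TangentSpace (𝓡 d) x) (F' := ℝ) (𝕜 := ℝ))
  refine ⟨(LinearEquiv.ofInjectiveOfFinrankEq (flat g x).toLinearMap hinj
    hdim).toContinuousLinearEquiv, ?_⟩
  ext v w
  rfl

theorem flat_sharp (g : Metric d M) (x : M) (α : Cotangent d x) :
    flat g x (sharp g x α) = α :=
  (flat_isInvertible g x).self_apply_inverse α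

theorem sharp_flat (g : Metric d M) (x : M) (v : TangentSpace (𝓡 d) x) :
    sharp g x (flat g x v) = v :=
  (flat_isInvertible g x).inverse_apply_self v

theorem inner_J (P : BivField d M) (g : Metric d M) (x : M) (α β : Cotangent d x) :
    g.inner x (J P g x (sharp g x α)) (sharp g x β) = P x α β := by
  rw [g.symm]
  change flat g x (sharp g x β) _ = _
  rw [flat_sharp, J, flat_sharp, apply_sharpPi]

theorem cometric_Jstar (P : BivField d M) (g : Metric d M) (x : M) (α β : Cotangent d x) :
    cometric g x (Jstar P g x α) β = P x α β := by
  rw [cometric, Jstar, sharp_flat, g.symm]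
  change flat g x (sharp g x β) _ = _
  rw [flat_sharp, apply_sharpPi]

end Triple

/-! ### Contact forms -/

section Contact

variable {d : ℕ} {M : Type*} [TopologicalSpace M]
  [ChartedSpace (EuclideanSpace ℝ (Fin d)) M]

/-- `♭_η(X) = -i_X dη + η(X) η`. -/
def flatContact (η : OneForm d M) (x : M) :
    TangentSpace (𝓡 d) x →L[ℝ] (TangentSpace (𝓡 d) x →L[ℝ] ℝ) :=
  -dform η x + (η x).smulRight (η x)

/-- `♯_η`, the inverse of `♭_η` (an isomorphism when `η` is a contact form). -/
def sharpContact (η : OneForm d M) (x : M) :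
    (TangentSpace (𝓡 d) x →L[ℝ] ℝ) →L[ℝ] TangentSpace (𝓡 d) x := (flatContact η x).inverse

/-- The Reeb field `ξ = ♯_η(η)`. -/
def reeb (η : OneForm d M) : VField d M := fun x => sharpContact η x (η x)

/-- The bivector field `π(α, β) = dη(♯_η(α), ♯_η(β))`. -/
def contactBivector (η : OneForm d M) : BivField d M := fun x =>
  LinearMap.mk₂ ℝ (fun α β : Cotangent d x =>
      dform η x (sharpContact η x α) (sharpContact η x β))
    (by intros; simp) (by intros; simp) (by intros; simp) (by intros; simp)

/-- The value of the `(2n+1)`-form `η ∧ (dη)^n` at `x` on the vectors `v 0, …, v (2n)`. -/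
def contactVolume {n : ℕ} {M : Type*} [TopologicalSpace M]
    [ChartedSpace (EuclideanSpace ℝ (Fin (2 * n + 1))) M] (η : OneForm (2 * n + 1) M) (x : M)
    (v : Fin (2 * n + 1) → TangentSpace (𝓡 (2 * n + 1)) x) : ℝ :=
  (1 / 2 : ℝ) ^ n * ∑ σ : Equiv.Perm (Fin (2 * n + 1)), ((Equiv.Perm.sign σ : ℤ) : ℝ) *
    (η x (v (σ 0)) * ∏ i : Fin n,
      dform η x (v (σ ⟨2 * i.1 + 1, by omega⟩)) (v (σ ⟨2 * i.1 + 2, by omega⟩)))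

/-- Contact forms: smooth `1`-forms `η` on a manifold of dimension `2n+1` such that
`η ∧ (dη)^n` is a volume form, i.e. vanishes at no point. -/
structure IsContactForm {n : ℕ} {M : Type*} [TopologicalSpace M]
    [ChartedSpace (EuclideanSpace ℝ (Fin (2 * n + 1))) M]
    [IsManifold (𝓡 (2 * n + 1)) ∞ M] (η : OneForm (2 * n + 1) M) : Prop where
  smooth : SmoothForm η
  volume : ∀ x : M, ∃ v : Fin (2 * n + 1) → TangentSpace (𝓡 (2 * n + 1)) x,
    contactVolume η x v ≠ 0

/-- `(η, g)` is a Riemannian contact structure with associated almost contact structure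
`(Φ, ξ, η, g)`, where `ξ` is the Reeb field: `η` is a contact form, `(Φ, ξ, η, g)` is a
Riemannian almost contact structure, and `g(X, Φ Y) = dη(X, Y)`. -/
structure IsRiemannianContact {n : ℕ} {M : Type*} [TopologicalSpace M]
    [ChartedSpace (EuclideanSpace ℝ (Fin (2 * n + 1))) M]
    [IsManifold (𝓡 (2 * n + 1)) ∞ M] (η : OneForm (2 * n + 1) M)
    (g : Metric (2 * n + 1) M) (Φ : EndField (2 * n + 1) M) : Prop where
  contact : IsContactForm η
  almostContact : IsRiemannianAlmostContact Φ (reeb η) η g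
  inner_Φ : ∀ (x : M) (v w : TangentSpace (𝓡 (2 * n + 1)) x),
    g.inner x v (Φ x w) = dform η x v w

end Contact

end JacobiRiemannian

end

/-! The isomorphism `♭_η : TM → T*M` carries the Riemannian geometry of `g` to the contravariant
geometry of `(π, ξ, g)`, so compatibility is the Kenmotsu identity read through `♭_η`.

Since `g(X, ΦY) = dη(X, Y)`, one has `♭_η = ♭_g ∘ (Φ + η ⊗ ξ)`, and `Φ + η ⊗ ξ` is a `g`-isometry
with inverse `-Φ + η ⊗ ξ`. Hence `♭_η` pulls `g*` back to `g` (`cometric_flatContact`), `π` back to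
`dη`, and the anchor `♯_{π,ξ}` is its inverse (`anchor_flatContact`). Moreover `λ = η`, and `♭_η`
turns the Lie bracket into `[·,·]^g_{π,ξ}` (`metricBracket_flatContact`); in a chart this is the
identity `d(dη) = 0` (`contactLower_bracket`). The two Koszul formulas therefore agree, and `D_{♭X}
♭Y = ♭(∇_X Y)` (`contraDeriv_flatContact`).

As `π(♭Y, ♭Z) = g(Y, ΦZ)` and `∇` is metric, `Dπ(♭X, ♭Y, ♭Z) = g(Y, (∇_X Φ)Z)`. On the other side
`J*γ(ξ) = 0`, and what remains is `½ (η(Z) dη(X, Y) - η(Y) dη(X, Z))`, which is `g(Y, ·)` of the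
Kenmotsu right-hand side. -/

set_option synthInstance.maxHeartbeats 200000

noncomputable section

namespace JacobiRiemannian

/-! ### The bracket identity for `♭_η` on a normed space -/

section VectorSpace

variable {E : Type*} [NormedAddCommGroup E] [NormedSpace ℝ E]

/-- The exterior derivative of a `1`-form on a normed space. -/
def curl (A : E → E →L[ℝ] ℝ) (e : E) : E →L[ℝ] E →L[ℝ] ℝ := fderiv ℝ A e - (fderiv ℝ A e).flip

theorem curl_apply (A : E → E →L[ℝ] ℝ) (e u v : E) :
    curl A e u v = fderiv ℝ A e u v - fderiv ℝ A e v u := rfl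

theorem DifferentiableAt.sub_clm_comp {F : Type*} [NormedAddCommGroup F] [NormedSpace ℝ F]
    (L : F →L[ℝ] F) {f : E → F} {e : E}
    (h : DifferentiableAt ℝ f e) : DifferentiableAt ℝ (fun e => f e - L (f e)) e :=
  h.fun_sub <| L.differentiableAt.comp e h

theorem differentiableAt_curl {A : E → E →L[ℝ] ℝ} {e : E}
    (hA : DifferentiableAt ℝ (fderiv ℝ A) e) : DifferentiableAt ℝ (curl A) e := by
  have h := DifferentiableAt.sub_clm_comp (F := E →L[ℝ] E →L[ℝ] ℝ) (E := E) (f := fderiv ℝ A)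
    (L := (ContinuousLinearMap.flipₗᵢ ℝ E E ℝ).toContinuousLinearEquiv.toContinuousLinearMap)
    (e := e) (by convert! hA)
  convert! h

theorem hasFDerivAt_curl_apply {A : E → E →L[ℝ] ℝ} {e : E}
    (hA : DifferentiableAt ℝ (fderiv ℝ A) e) :
    ∃ D : E →L[ℝ] E →L[ℝ] E →L[ℝ] ℝ, HasFDerivAt (curl A) D e ∧ ∀ u v w, D u v w =
      fderiv ℝ (fderiv ℝ A) e u v w - fderiv ℝ (fderiv ℝ A) e u w v := by
  have h := (differentiableAt_curl hA).hasFDerivAt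
  refine ⟨_, h, fun u v w => ?_⟩
  -- Evaluating on constant vectors `v`, `w` reduces the claim to derivatives of scalar functions.
  have h1 := ((h.clm_apply (hasFDerivAt_const v e)).clm_apply (hasFDerivAt_const w e)).fderiv
  have h2 := ((hA.hasFDerivAt.clm_apply (hasFDerivAt_const v e)).clm_apply
    (hasFDerivAt_const w e))
  have h3 := ((hA.hasFDerivAt.clm_apply (hasFDerivAt_const w e)).clm_apply
    (hasFDerivAt_const v e))
  have h4 := (h2.fun_sub h3).fderiv
  have h5 := congrArg (fun L => L u) (h1.symm.trans h4)
  simpa using h5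

/-- The form `-i_X dA + A(X) A`. -/
def contactLower (A : E → E →L[ℝ] ℝ) (X : E → E) (e : E) : E →L[ℝ] ℝ :=
  -curl A e (X e) + A e (X e) • A e

theorem hasFDerivAt_contactLower {A : E → E →L[ℝ] ℝ} {X : E → E} {e : E}
    (hA : DifferentiableAt ℝ A e) (hA' : DifferentiableAt ℝ (fderiv ℝ A) e)
    (hX : DifferentiableAt ℝ X e) :
    ∃ L : E →L[ℝ] E →L[ℝ] ℝ, HasFDerivAt (contactLower A X) L e ∧ ∀ u w, L u w =
      -(fderiv ℝ (fderiv ℝ A) e u (X e) w - fderiv ℝ (fderiv ℝ A) e u w (X e))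
      - curl A e (fderiv ℝ X e u) w
      + (fderiv ℝ A e u (X e) + A e (fderiv ℝ X e u)) * A e w + A e (X e) * fderiv ℝ A e u w := by
  obtain ⟨D, hD, hDe⟩ := hasFDerivAt_curl_apply hA'
  have h1 := (hD.clm_apply hX.hasFDerivAt).neg
  have h2 := HasFDerivAt.smul (𝕜 := ℝ) (𝕜' := ℝ) (hA.hasFDerivAt.clm_apply hX.hasFDerivAt)
    hA.hasFDerivAt
  have h3 := h1.add h2
  refine ⟨_, h3, fun u w => ?_⟩
  simp [hDe]
  ring

/-- After expansion by the product rule, the terms of first order in `A` match algebraically. The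
second derivatives of `A` assemble into `-d(dA)(X, Y, w)`, which vanishes by `hsymm`. -/
theorem contactLower_bracket {A : E → E →L[ℝ] ℝ} {X Y : E → E} {e : E}
    (hA : DifferentiableAt ℝ A e) (hA' : DifferentiableAt ℝ (fderiv ℝ A) e)
    (hsymm : ∀ u v w, fderiv ℝ (fderiv ℝ A) e u v w = fderiv ℝ (fderiv ℝ A) e v u w)
    (hX : DifferentiableAt ℝ X e) (hY : DifferentiableAt ℝ Y e) (w : E) :
    curl (contactLower A Y) e (X e) w - curl (contactLower A X) e (Y e) w
      + fderiv ℝ (fun e => curl A e (X e) (Y e)) e w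
      + A e (X e) * fderiv ℝ (fun e => A e (Y e)) e w
      - A e (Y e) * fderiv ℝ (fun e => A e (X e)) e w
      - A e (X e) * contactLower A Y e w + A e (Y e) * contactLower A X e w
      - curl A e (X e) (Y e) * A e w
    = -curl A e (VectorField.lieBracket ℝ X Y e) w
      + A e (VectorField.lieBracket ℝ X Y e) * A e w := by
  obtain ⟨D, hD, hDe⟩ := hasFDerivAt_curl_apply hA'
  obtain ⟨LX, hLX, hLXe⟩ := hasFDerivAt_contactLower hA hA' hX
  obtain ⟨LY, hLY, hLYe⟩ := hasFDerivAt_contactLower hA hA' hY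
  have h1 := ((hD.clm_apply hX.hasFDerivAt).clm_apply hY.hasFDerivAt).fderiv
  have h2 := (hA.hasFDerivAt.clm_apply hX.hasFDerivAt).fderiv
  have h3 := (hA.hasFDerivAt.clm_apply hY.hasFDerivAt).fderiv
  rw [h1, h2, h3]
  simp only [curl_apply (contactLower _ _), hLX.fderiv, hLY.fderiv, hLXe, hLYe,
    VectorField.lieBracket_eq, contactLower]
  simp [hDe, curl_apply]
  have s1 := hsymm (X e) (Y e) w
  have s2 := hsymm (X e) w (Y e)
  have s3 := hsymm w (Y e) (X e)
  -- These three symmetries together are `d(dA)(X, Y, w) = 0`.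
  linear_combination -s1 + s2 + s3

end VectorSpace

/-! ### Fields, brackets and differentials read in the preferred chart -/

section Charts

open Filter Set Topology

variable {d : ℕ} {M : Type*} [TopologicalSpace M]
  [ChartedSpace (EuclideanSpace ℝ (Fin d)) M]

/-- The expression of a vector field in the preferred chart at `x₀`. -/
def chartVec (X : VField d M) (x₀ : M) (e : EuclideanSpace ℝ (Fin d)) : EuclideanSpace ℝ (Fin d) :=
  (mfderiv 𝓘(ℝ, EuclideanSpace ℝ (Fin d)) (𝓡 d) (extChartAt (𝓡 d) x₀).symm e).inverse
    (X ((extChartAt (𝓡 d) x₀).symm e))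

theorem chartVec_eq (X : VField d M) (x₀ : M) :
    chartVec X x₀ = VectorField.mpullbackWithin 𝓘(ℝ, EuclideanSpace ℝ (Fin d)) (𝓡 d)
      (extChartAt (𝓡 d) x₀).symm X (range (𝓡 d)) := by
  ext1 e
  simp only [chartVec, VectorField.mpullbackWithin_apply, modelWithCornersSelf_coe, range_id,
    mfderivWithin_univ]
  rfl

theorem target_mem_nhds {x₀ : M} {e : EuclideanSpace ℝ (Fin d)}
    (he : e ∈ (extChartAt (𝓡 d) x₀).target) : (extChartAt (𝓡 d) x₀).target ∈ 𝓝 e :=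
  (isOpen_extChartAt_target x₀).mem_nhds he

variable [IsManifold (𝓡 d) ∞ M]

theorem isInvertible_mfderiv_chart_symm {x₀ : M} {e : EuclideanSpace ℝ (Fin d)}
    (he : e ∈ (extChartAt (𝓡 d) x₀).target) :
    (mfderiv 𝓘(ℝ, EuclideanSpace ℝ (Fin d)) (𝓡 d) (extChartAt (𝓡 d) x₀).symm e).IsInvertible := by
  have := isInvertible_mfderivWithin_extChartAt_symm he
  simpa only [modelWithCornersSelf_coe, range_id, mfderivWithin_univ] using this

theorem mfderiv_chart_symm_chartVec (X : VField d M) {x₀ : M} {e : EuclideanSpace ℝ (Fin d)}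
    (he : e ∈ (extChartAt (𝓡 d) x₀).target) :
    mfderiv 𝓘(ℝ, EuclideanSpace ℝ (Fin d)) (𝓡 d) (extChartAt (𝓡 d) x₀).symm e (chartVec X x₀ e)
      = X ((extChartAt (𝓡 d) x₀).symm e) :=
  (isInvertible_mfderiv_chart_symm he).self_apply_inverse _

theorem chartForm_apply_chartVec (β : OneForm d M) (X : VField d M) {x₀ : M}
    {e : EuclideanSpace ℝ (Fin d)} (he : e ∈ (extChartAt (𝓡 d) x₀).target) :
    chartForm β x₀ e (chartVec X x₀ e) =
      β ((extChartAt (𝓡 d) x₀).symm e) (X ((extChartAt (𝓡 d) x₀).symm e)) := by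
  conv_rhs => rw [← mfderiv_chart_symm_chartVec X he]
  rfl

theorem differentiableAt_chartVec {X : VField d M} {x₀ : M} (hX : DiffVFieldAt X x₀) :
    DifferentiableAt ℝ (chartVec X x₀) (extChartAt (𝓡 d) x₀ x₀) := by
  have := (mdifferentiableWithinAt_univ.2 hX).differentiableWithinAt_mpullbackWithin_vectorField
  rw [← chartVec_eq] at this
  simpa only [preimage_univ, modelWithCornersSelf_coe, range_id, inter_self,
    differentiableWithinAt_univ] using this

/-- The tangent space at `x₀` is identified with the model space through the preferred chart at `x₀`
itself, so values at the base point need no transport. -/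
theorem mfderiv_chart_symm_self (x₀ : M) :
    mfderiv 𝓘(ℝ, EuclideanSpace ℝ (Fin d)) (𝓡 d) (extChartAt (𝓡 d) x₀).symm
      (extChartAt (𝓡 d) x₀ x₀) = ContinuousLinearMap.id ℝ (EuclideanSpace ℝ (Fin d)) := by
  have := mfderivWithin_range_extChartAt_symm (I := 𝓡 d) (x := x₀)
  simpa only [modelWithCornersSelf_coe, range_id, mfderivWithin_univ] using! this

theorem chartForm_self (β : OneForm d M) (x₀ : M) :
    chartForm β x₀ (extChartAt (𝓡 d) x₀ x₀) = β x₀ := by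
  rw [chartForm, mfderiv_chart_symm_self, extChartAt_to_inv]
  rfl

theorem chartVec_self (X : VField d M) (x₀ : M) :
    chartVec X x₀ (extChartAt (𝓡 d) x₀ x₀) = X x₀ := by
  rw [chartVec, mfderiv_chart_symm_self, extChartAt_to_inv]
  exact congrArg (fun L : EuclideanSpace ℝ (Fin d) →L[ℝ] EuclideanSpace ℝ (Fin d) => L (X x₀))
    ContinuousLinearMap.inverse_id

theorem mlieBracket_eq_chart (X Y : VField d M) (x₀ : M) :
    VectorField.mlieBracket (𝓡 d) X Y x₀ =
      VectorField.lieBracket ℝ (chartVec X x₀) (chartVec Y x₀) (extChartAt (𝓡 d) x₀ x₀) := by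
  rw [← VectorField.mlieBracketWithin_univ, VectorField.mlieBracketWithin_apply,
    ← chartVec_eq, ← chartVec_eq, mfderiv_extChartAt_self]
  simp only [preimage_univ, modelWithCornersSelf_coe, range_id, inter_self,
    VectorField.lieBracketWithin_univ]
  exact congrArg (fun L : EuclideanSpace ℝ (Fin d) →L[ℝ] EuclideanSpace ℝ (Fin d) => L _)
    ContinuousLinearMap.inverse_id

theorem dform_eq_chart (β : OneForm d M) (x₀ : M) :
    dform β x₀ = curl (chartForm β x₀) (extChartAt (𝓡 d) x₀ x₀) := by
  ext u v
  simp only [dform, mfderiv_extChartAt_self]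
  rfl

theorem dfun_eq_chart {f : M → ℝ} {F : EuclideanSpace ℝ (Fin d) → ℝ} {x₀ : M}
    (hF : DifferentiableAt ℝ F (extChartAt (𝓡 d) x₀ x₀))
    (h : ∀ᶠ e in 𝓝 (extChartAt (𝓡 d) x₀ x₀), F e = f ((extChartAt (𝓡 d) x₀).symm e)) :
    dfun f x₀ = fderiv ℝ F (extChartAt (𝓡 d) x₀ x₀) := by
  have h1 : f =ᶠ[𝓝 x₀] F ∘ extChartAt (𝓡 d) x₀ := by
    filter_upwards [(continuousAt_extChartAt x₀).eventually h,
      extChartAt_source_mem_nhds (I := 𝓡 d) x₀] with y hy hy'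
    rw [Function.comp_apply, hy, (extChartAt (𝓡 d) x₀).left_inv hy']
  have h2 : HasMFDerivAt (𝓡 d) 𝓘(ℝ, ℝ) (F ∘ extChartAt (𝓡 d) x₀) x₀ _ :=
    HasMFDerivAt.comp x₀ hF.hasFDerivAt.hasMFDerivAt
      (mdifferentiableAt_extChartAt (mem_chart_source _ x₀)).hasMFDerivAt
  rw [dfun, mvfderiv, (h2.congr_of_eventuallyEq h1).mfderiv, mfderiv_extChartAt_self]
  rfl

end Charts

/-! ### Regularity of forms in charts and chart independence of `d` -/

section Forms

open Filter Set Topology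

variable {d : ℕ} {M : Type*} [TopologicalSpace M]
  [ChartedSpace (EuclideanSpace ℝ (Fin d)) M] [IsManifold (𝓡 d) ∞ M]

/-- The tangent bundle is trivialised by the derivative of the chart. Bundle regularity of a form
thus becomes regularity of its chart expression. -/
theorem inCoordinates_chart_symm (β : OneForm d M) {x₀ : M} {e : EuclideanSpace ℝ (Fin d)}
    (he : e ∈ (extChartAt (𝓡 d) x₀).target) :
    ContinuousLinearMap.inCoordinates (EuclideanSpace ℝ (Fin d))
      (fun y : M => TangentSpace (𝓡 d) y) ℝ (Bundle.Trivial M ℝ)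
      x₀ ((extChartAt (𝓡 d) x₀).symm e) x₀ ((extChartAt (𝓡 d) x₀).symm e)
      (β ((extChartAt (𝓡 d) x₀).symm e)) = chartForm β x₀ e := by
  have hs : (extChartAt (𝓡 d) x₀).symm e ∈ (chartAt (EuclideanSpace ℝ (Fin d)) x₀).source := by
    simpa only [extChartAt_source] using (extChartAt (𝓡 d) x₀).map_target he
  rw [ContinuousLinearMap.inCoordinates, TangentBundle.symmL_trivializationAt hs,
    (extChartAt (𝓡 d) x₀).right_inv he]
  simp only [modelWithCornersSelf_coe, range_id, mfderivWithin_univ]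
  ext v
  simp [chartForm]

theorem differentiableAt_chartForm {β : OneForm d M} {x₀ : M} (hβ : DiffFormAt β x₀) :
    DifferentiableAt ℝ (chartForm β x₀) (extChartAt (𝓡 d) x₀ x₀) := by
  have h := ((mdifferentiableAt_hom_bundle (E₂ := Bundle.Trivial M ℝ) _).1 hβ).2
  have h1 : MDifferentiableAt 𝓘(ℝ, EuclideanSpace ℝ (Fin d)) (𝓡 d) (extChartAt (𝓡 d) x₀).symm
      (extChartAt (𝓡 d) x₀ x₀) :=
    mdifferentiableWithinAt_univ.1 (by
      simpa using mdifferentiableWithinAt_extChartAt_symm (I := 𝓡 d) (mem_extChartAt_target x₀))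
  have h2 := (MDifferentiableAt.comp_of_eq _ h h1 (extChartAt_to_inv x₀)).differentiableAt
  refine h2.congr_of_eventuallyEq ?_
  filter_upwards [target_mem_nhds (mem_extChartAt_target x₀)] with e he
  exact (inCoordinates_chart_symm β he).symm

theorem contDiffAt_chartForm {β : OneForm d M} (hβ : SmoothForm β) (x₀ : M) :
    ContDiffAt ℝ ∞ (chartForm β x₀) (extChartAt (𝓡 d) x₀ x₀) := by
  have h := ((contMDiffAt_hom_bundle (E₂ := Bundle.Trivial M ℝ) _).1 (hβ x₀)).2
  have h1 : ContMDiffAt 𝓘(ℝ, EuclideanSpace ℝ (Fin d)) (𝓡 d) ∞ (extChartAt (𝓡 d) x₀).symm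
      (extChartAt (𝓡 d) x₀ x₀) :=
    (contMDiffOn_extChartAt_symm x₀).contMDiffAt (target_mem_nhds (mem_extChartAt_target x₀))
  have h2 := (ContMDiffAt.comp_of_eq h h1 (extChartAt_to_inv x₀)).contDiffAt
  refine h2.congr_of_eventuallyEq ?_
  filter_upwards [target_mem_nhds (mem_extChartAt_target x₀)] with e he
  exact (inCoordinates_chart_symm β he).symm

theorem SmoothForm.diffFormAt {β : OneForm d M} (hβ : SmoothForm β) (x : M) : DiffFormAt β x :=
  (hβ x).mdifferentiableAt (by simp)

/-- Naturality of `d`: the term containing the second derivative of `τ` is symmetric in `u`, `v` and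
drops out on antisymmetrising. -/
theorem curl_pullback {E : Type*} [NormedAddCommGroup E] [NormedSpace ℝ E] {B : E → E →L[ℝ] ℝ}
    {τ : E → E} {e : E} (hB : DifferentiableAt ℝ B (τ e)) (hτ : ContDiffAt ℝ 2 τ e) (u v : E) :
    curl (fun e' => (B (τ e')).comp (fderiv ℝ τ e')) e u v =
      curl B (τ e) (fderiv ℝ τ e u) (fderiv ℝ τ e v) := by
  have h1 : DifferentiableAt ℝ τ e := hτ.differentiableAt (by simp)
  have h2 : DifferentiableAt ℝ (fderiv ℝ τ) e :=
    (hτ.fderiv_right (m := 1) (by norm_num)).differentiableAt (by simp)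
  have h3 : IsSymmSndFDerivAt ℝ τ e := hτ.isSymmSndFDerivAt (by simp)
  have h4 := ((hB.hasFDerivAt.comp e h1.hasFDerivAt).clm_comp h2.hasFDerivAt).fderiv
  simp only [Function.comp_def] at h4
  rw [curl_apply, h4, curl_apply]
  simp [h3.eq u v]

omit [IsManifold (𝓡 d) ∞ M] in
theorem mem_change_source {x₀ y : M} {e : EuclideanSpace ℝ (Fin d)}
    (he : e ∈ (extChartAt (𝓡 d) x₀).target)
    (hy : (extChartAt (𝓡 d) x₀).symm e ∈ (extChartAt (𝓡 d) y).source) :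
    e ∈ ((extChartAt (𝓡 d) x₀).symm ≫ extChartAt (𝓡 d) y).source := by
  rw [PartialEquiv.trans_source]
  exact ⟨he, hy⟩

omit [IsManifold (𝓡 d) ∞ M] in
theorem change_source_mem_nhds {x₀ y : M} {e : EuclideanSpace ℝ (Fin d)}
    (he : e ∈ (extChartAt (𝓡 d) x₀).target)
    (hy : (extChartAt (𝓡 d) x₀).symm e ∈ (extChartAt (𝓡 d) y).source) :
    {e' | e' ∈ (extChartAt (𝓡 d) x₀).target ∧
      (extChartAt (𝓡 d) x₀).symm e' ∈ (extChartAt (𝓡 d) y).source} ∈ 𝓝 e :=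
  inter_mem (target_mem_nhds he) ((continuousAt_extChartAt_symm'' he).preimage_mem_nhds
    ((isOpen_extChartAt_source y).mem_nhds hy))

theorem contDiffAt_change {x₀ y : M} {e : EuclideanSpace ℝ (Fin d)}
    (he : e ∈ (extChartAt (𝓡 d) x₀).target)
    (hy : (extChartAt (𝓡 d) x₀).symm e ∈ (extChartAt (𝓡 d) y).source) :
    ContDiffAt ℝ ∞ (extChartAt (𝓡 d) y ∘ (extChartAt (𝓡 d) x₀).symm) e := by
  have := contDiffWithinAt_ext_coord_change (I := 𝓡 d) (n := ∞) y x₀ (mem_change_source he hy)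
  simpa only [modelWithCornersSelf_coe, range_id, contDiffWithinAt_univ] using this

theorem mfderiv_chart_symm_change {x₀ y : M} {e : EuclideanSpace ℝ (Fin d)}
    (he : e ∈ (extChartAt (𝓡 d) x₀).target)
    (hy : (extChartAt (𝓡 d) x₀).symm e ∈ (extChartAt (𝓡 d) y).source) :
    mfderiv 𝓘(ℝ, EuclideanSpace ℝ (Fin d)) (𝓡 d) (extChartAt (𝓡 d) x₀).symm e =
      (mfderiv 𝓘(ℝ, EuclideanSpace ℝ (Fin d)) (𝓡 d) (extChartAt (𝓡 d) y).symm
        (extChartAt (𝓡 d) y ((extChartAt (𝓡 d) x₀).symm e))).comp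
        (fderiv ℝ (extChartAt (𝓡 d) y ∘ (extChartAt (𝓡 d) x₀).symm) e) := by
  have h1 : MDifferentiableAt 𝓘(ℝ, EuclideanSpace ℝ (Fin d)) (𝓡 d) (extChartAt (𝓡 d) y).symm
      (extChartAt (𝓡 d) y ((extChartAt (𝓡 d) x₀).symm e)) :=
    mdifferentiableWithinAt_univ.1 (by
      simpa using mdifferentiableWithinAt_extChartAt_symm (I := 𝓡 d)
        ((extChartAt (𝓡 d) y).map_source hy))
  have h2 := ((contDiffAt_change he hy).differentiableAt (by simp)).hasFDerivAt.hasMFDerivAt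
  have h3 : HasMFDerivAt 𝓘(ℝ, EuclideanSpace ℝ (Fin d)) (𝓡 d) ((extChartAt (𝓡 d) y).symm ∘
      (extChartAt (𝓡 d) y ∘ (extChartAt (𝓡 d) x₀).symm)) e _ :=
    HasMFDerivAt.comp e h1.hasMFDerivAt h2
  refine (h3.congr_of_eventuallyEq ?_).mfderiv
  filter_upwards [change_source_mem_nhds he hy] with e' he'
  exact ((extChartAt (𝓡 d) y).left_inv he'.2).symm

theorem chartForm_change (η : OneForm d M) {x₀ y : M} {e : EuclideanSpace ℝ (Fin d)}
    (he : e ∈ (extChartAt (𝓡 d) x₀).target)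
    (hy : (extChartAt (𝓡 d) x₀).symm e ∈ (extChartAt (𝓡 d) y).source) :
    chartForm η x₀ e =
      (chartForm η y ((extChartAt (𝓡 d) y ∘ (extChartAt (𝓡 d) x₀).symm) e)).comp
        (fderiv ℝ (extChartAt (𝓡 d) y ∘ (extChartAt (𝓡 d) x₀).symm) e) := by
  rw [chartForm, mfderiv_chart_symm_change he hy]
  have h := congrArg (fun z : M => (show EuclideanSpace ℝ (Fin d) →L[ℝ] ℝ from η z))
    ((extChartAt (𝓡 d) y).left_inv hy)
  ext v
  exact (congrArg (fun L : EuclideanSpace ℝ (Fin d) →L[ℝ] ℝ => L _) h).symm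

/-- `dform` is computed at each point in that point's own chart. Naturality under the change of
charts allows a single chart to serve on a whole neighbourhood, which is needed to differentiate
expressions involving `dη`. -/
theorem dform_chart_symm {η : OneForm d M} (hη : SmoothForm η) {x₀ : M}
    {e : EuclideanSpace ℝ (Fin d)} (he : e ∈ (extChartAt (𝓡 d) x₀).target)
    (u v : EuclideanSpace ℝ (Fin d)) :
    dform η ((extChartAt (𝓡 d) x₀).symm e)
      (mfderiv 𝓘(ℝ, EuclideanSpace ℝ (Fin d)) (𝓡 d) (extChartAt (𝓡 d) x₀).symm e u)
      (mfderiv 𝓘(ℝ, EuclideanSpace ℝ (Fin d)) (𝓡 d) (extChartAt (𝓡 d) x₀).symm e v)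
      = curl (chartForm η x₀) e u v := by
  obtain ⟨y, hy⟩ : ∃ y, y = (extChartAt (𝓡 d) x₀).symm e := ⟨_, rfl⟩
  have hys : (extChartAt (𝓡 d) x₀).symm e ∈ (extChartAt (𝓡 d) y).source :=
    hy ▸ mem_extChartAt_source y
  have hev : chartForm η x₀ =ᶠ[𝓝 e] fun e' =>
      (chartForm η y ((extChartAt (𝓡 d) y ∘ (extChartAt (𝓡 d) x₀).symm) e')).comp
        (fderiv ℝ (extChartAt (𝓡 d) y ∘ (extChartAt (𝓡 d) x₀).symm) e') := by
    filter_upwards [change_source_mem_nhds he hys] with e' he'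
    exact chartForm_change η he'.1 he'.2
  have hyτ : extChartAt (𝓡 d) y y = (extChartAt (𝓡 d) y ∘ (extChartAt (𝓡 d) x₀).symm) e := by
    rw [Function.comp_apply, ← hy]
  have hB : DifferentiableAt ℝ (chartForm η y)
      ((extChartAt (𝓡 d) y ∘ (extChartAt (𝓡 d) x₀).symm) e) := by
    rw [← hyτ]
    exact differentiableAt_chartForm (hη.diffFormAt y)
  have hcurl := curl_pullback hB ((contDiffAt_change he hys).of_le ENat.LEInfty.out) u v
  have h1 : curl (chartForm η x₀) e u v = curl (chartForm η y) (extChartAt (𝓡 d) y y)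
      (fderiv ℝ (extChartAt (𝓡 d) y ∘ (extChartAt (𝓡 d) x₀).symm) e u)
      (fderiv ℝ (extChartAt (𝓡 d) y ∘ (extChartAt (𝓡 d) x₀).symm) e v) := by
    rw [hyτ, ← hcurl, curl_apply, curl_apply, hev.fderiv_eq]
  have h2 : ∀ w : EuclideanSpace ℝ (Fin d),
      mfderiv 𝓘(ℝ, EuclideanSpace ℝ (Fin d)) (𝓡 d) (extChartAt (𝓡 d) x₀).symm e w =
      (fderiv ℝ (extChartAt (𝓡 d) y ∘ (extChartAt (𝓡 d) x₀).symm) e w) := by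
    intro w
    rw [mfderiv_chart_symm_change he hys, ← hy, mfderiv_chart_symm_self]
    rfl
  rw [h1, h2 u, h2 v, ← dform_eq_chart, ← hy]
  rfl

end Forms

/-! ### The bracket identity for `♭_η` on the manifold -/

section ContactBracket

open Filter Set Topology

variable {d : ℕ} {M : Type*} [TopologicalSpace M]
  [ChartedSpace (EuclideanSpace ℝ (Fin d)) M]

theorem flatContact_apply (η : OneForm d M) (x : M) (u w : TangentSpace (𝓡 d) x) :
    flatContact η x u w = -dform η x u w + η x u * η x w := rfl

theorem dform_swap (η : OneForm d M) (x : M) (u w : TangentSpace (𝓡 d) x) :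
    dform η x u w = -dform η x w u :=
  (neg_sub _ _).symm

variable [IsManifold (𝓡 d) ∞ M]

theorem chartForm_flatContact {η : OneForm d M} (hη : SmoothForm η) (X : VField d M) {x₀ : M}
    {e : EuclideanSpace ℝ (Fin d)} (he : e ∈ (extChartAt (𝓡 d) x₀).target) :
    chartForm (fun y => flatContact η y (X y)) x₀ e =
      contactLower (chartForm η x₀) (chartVec X x₀) e := by
  ext w
  change flatContact η _ (X _) (mfderiv 𝓘(ℝ, EuclideanSpace ℝ (Fin d)) (𝓡 d)
    (extChartAt (𝓡 d) x₀).symm e w) = -curl _ e _ w + _ * _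
  rw [flatContact_apply, ← mfderiv_chart_symm_chartVec X he, dform_chart_symm hη he]
  rfl

theorem dfun_apply_eq_chart {η : OneForm d M} {X : VField d M} {x₀ : M} (hη : DiffFormAt η x₀)
    (hX : DiffVFieldAt X x₀) :
    dfun (fun y => η y (X y)) x₀ =
      fderiv ℝ (fun e => chartForm η x₀ e (chartVec X x₀ e)) (extChartAt (𝓡 d) x₀ x₀) := by
  refine dfun_eq_chart ((differentiableAt_chartForm hη).clm_apply (differentiableAt_chartVec hX)) ?_
  filter_upwards [target_mem_nhds (mem_extChartAt_target x₀)] with e he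
  exact chartForm_apply_chartVec η X he

theorem differentiableAt_fderiv_chartForm {η : OneForm d M} (hη : SmoothForm η) (x₀ : M) :
    DifferentiableAt ℝ (fderiv ℝ (chartForm η x₀)) (extChartAt (𝓡 d) x₀ x₀) :=
  ((contDiffAt_chartForm hη x₀).fderiv_right (m := 1) (by
    rw [one_add_one_eq_two]
    exact ENat.LEInfty.out)).differentiableAt (by simp)

theorem dfun_dform_eq_chart {η : OneForm d M} {X Y : VField d M} {x₀ : M} (hη : SmoothForm η)
    (hX : DiffVFieldAt X x₀) (hY : DiffVFieldAt Y x₀) :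
    dfun (fun y => dform η y (X y) (Y y)) x₀ =
      fderiv ℝ (fun e => curl (chartForm η x₀) e (chartVec X x₀ e) (chartVec Y x₀ e))
        (extChartAt (𝓡 d) x₀ x₀) := by
  refine dfun_eq_chart (((differentiableAt_curl (differentiableAt_fderiv_chartForm hη x₀)).clm_apply
    (differentiableAt_chartVec hX)).clm_apply (differentiableAt_chartVec hY)) ?_
  filter_upwards [target_mem_nhds (mem_extChartAt_target x₀)] with e he
  rw [← dform_chart_symm hη he, mfderiv_chart_symm_chartVec X he, mfderiv_chart_symm_chartVec Y he]

/-- The contact isomorphism `♭_η` carries the Lie bracket of vector fields to a bracket of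
`1`-forms. -/
theorem flatContact_mlieBracket {η : OneForm d M} (hη : SmoothForm η) {X Y : VField d M} {x : M}
    (hX : DiffVFieldAt X x) (hY : DiffVFieldAt Y x) (w : TangentSpace (𝓡 d) x) :
    flatContact η x (VectorField.mlieBracket (𝓡 d) X Y x) w =
      dform (fun y => flatContact η y (Y y)) x (X x) w
        - dform (fun y => flatContact η y (X y)) x (Y x) w
        + dfun (fun y => dform η y (X y) (Y y)) x w
        + η x (X x) * dfun (fun y => η y (Y y)) x w
        - η x (Y x) * dfun (fun y => η y (X y)) x w
        - η x (X x) * flatContact η x (Y x) w + η x (Y x) * flatContact η x (X x) w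
        - dform η x (X x) (Y x) * η x w := by
  have hA := contDiffAt_chartForm hη x
  have hA1 := differentiableAt_chartForm (hη.diffFormAt x)
  have hA2 := differentiableAt_fderiv_chartForm hη x
  have key := contactLower_bracket hA1 hA2
    (fun u v w => by
      rw [(hA.isSymmSndFDerivAt (by simpa using ENat.LEInfty.out)).eq u v])
    (differentiableAt_chartVec hX)
    (differentiableAt_chartVec hY) w
  have hL : ∀ Z : VField d M, dform (fun y => flatContact η y (Z y)) x =
      curl (contactLower (chartForm η x) (chartVec Z x)) (extChartAt (𝓡 d) x x) := by
    intro Z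
    have : chartForm (fun y => flatContact η y (Z y)) x =ᶠ[𝓝 (extChartAt (𝓡 d) x x)]
        contactLower (chartForm η x) (chartVec Z x) := by
      filter_upwards [target_mem_nhds (mem_extChartAt_target x)] with e he
      exact chartForm_flatContact hη Z he
    rw [dform_eq_chart, curl, curl, this.fderiv_eq]
  rw [hL, hL, dfun_dform_eq_chart hη hX hY, dfun_apply_eq_chart (hη.diffFormAt x) hX,
    dfun_apply_eq_chart (hη.diffFormAt x) hY, mlieBracket_eq_chart]
  have hF : ∀ u : TangentSpace (𝓡 d) x, flatContact η x u w =
      -curl (chartForm η x) (extChartAt (𝓡 d) x x) u w + η x u * η x w := by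
    intro u
    rw [flatContact_apply, dform_eq_chart]
    rfl
  rw [hF (Y x), hF (X x), dform_eq_chart η]
  simp only [contactLower, chartVec_self, chartForm_self] at key
  exact (hF _).trans key.symm

end ContactBracket

/-! ### The Levi-Civita connection from the Koszul formula -/

section LeviCivita

open Filter Set Topology

variable {d : ℕ} {M : Type*} [TopologicalSpace M]
  [ChartedSpace (EuclideanSpace ℝ (Fin d)) M]

theorem dfun_mul {f h : M → ℝ} {x : M} (hf : MDifferentiableAt (𝓡 d) 𝓘(ℝ, ℝ) f x)
    (hh : MDifferentiableAt (𝓡 d) 𝓘(ℝ, ℝ) h x) (v : TangentSpace (𝓡 d) x) :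
    dfun (fun y => f y * h y) x v = f x * dfun h x v + h x * dfun f x v := by
  simp [dfun, mvfderiv_fun_mul hf hh]

theorem dfun_add {f h : M → ℝ} {x : M} (hf : MDifferentiableAt (𝓡 d) 𝓘(ℝ, ℝ) f x)
    (hh : MDifferentiableAt (𝓡 d) 𝓘(ℝ, ℝ) h x) (v : TangentSpace (𝓡 d) x) :
    dfun (fun y => f y + h y) x v = dfun f x v + dfun h x v := by
  simp [dfun, mvfderiv_fun_add hf hh]

variable [IsManifold (𝓡 d) ∞ M]

theorem SmoothVField.diffVFieldAt {X : VField d M} (hX : SmoothVField X) (x : M) :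
    DiffVFieldAt X x :=
  (hX x).mdifferentiableAt (by simp)

theorem exists_diffVFieldAt {x : M} (v : TangentSpace (𝓡 d) x) :
    ∃ X : VField d M, DiffVFieldAt X x ∧ X x = v :=
  ⟨FiberBundle.extend (EuclideanSpace ℝ (Fin d)) v,
    FiberBundle.mdifferentiableAt_extend (𝓡 d) _ v, by simp⟩

theorem mdifferentiableAt_inner (g : Metric d M) {X Y : VField d M} {x : M}
    (hX : DiffVFieldAt X x) (hY : DiffVFieldAt Y x) :
    MDifferentiableAt (𝓡 d) 𝓘(ℝ, ℝ) (fun y => g.inner y (X y) (Y y)) x := by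
  have hg := (g.contMDiff x).mdifferentiableAt (by simp)
  have := MDifferentiableAt.clm_bundle_apply₂ (E₃ := Bundle.Trivial M ℝ) (F₃ := ℝ) hg hX hY
  exact ((mdifferentiableAt_totalSpace (𝓡 d) _).1 this).2

/-- When `Z` is replaced by `f • Z`, the derivatives of `f` produced by the first two terms cancel
those produced by the brackets `[Y, fZ]` and `[X, fZ]`. -/
theorem tensorialAt_leviCivitaKoszul (g : Metric d M) {X Y : VField d M} {x : M}
    (hX : DiffVFieldAt X x) (hY : DiffVFieldAt Y x) :
    TensorialAt (𝓡 d) (EuclideanSpace ℝ (Fin d)) (fun Z => leviCivitaKoszul g X Y Z x) x where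
  smul := by
    intro f Z hf hZ
    have h1 : dfun (fun y => g.inner y (Y y) ((f • Z) y)) x (X x) =
        f x * dfun (fun y => g.inner y (Y y) (Z y)) x (X x) +
          g.inner x (Y x) (Z x) * dfun f x (X x) := by
      rw [← dfun_mul hf (mdifferentiableAt_inner g hY hZ)]
      simp
    have h2 : dfun (fun y => g.inner y (X y) ((f • Z) y)) x (Y x) =
        f x * dfun (fun y => g.inner y (X y) (Z y)) x (Y x) +
          g.inner x (X x) (Z x) * dfun f x (Y x) := by
      rw [← dfun_mul hf (mdifferentiableAt_inner g hX hZ)]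
      simp
    have h3 := VectorField.mlieBracket_smul_right (V := X) hf hZ
    have h4 := VectorField.mlieBracket_smul_right (V := Y) hf hZ
    simp only [leviCivitaKoszul, h1, h2, h3, h4]
    simp only [Pi.smul_apply', map_add, map_smul, add_apply, smul_apply, smul_eq_mul]
    rw [g.symm x (Z x) (X x), g.symm x (Z x) (Y x)]
    simp only [dfun]
    ring
  add := by
    intro Z W hZ hW
    have h1 : ∀ {X : VField d M}, DiffVFieldAt X x → ∀ v : TangentSpace (𝓡 d) x,
        dfun (fun y => g.inner y (X y) ((Z + W) y)) x v =
        dfun (fun y => g.inner y (X y) (Z y)) x v + dfun (fun y => g.inner y (X y) (W y)) x v := by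
      intro X hX v
      rw [← dfun_add (mdifferentiableAt_inner g hX hZ) (mdifferentiableAt_inner g hX hW)]
      simp
    have h3 := VectorField.mlieBracket_add_right (V := X) hZ hW
    have h4 := VectorField.mlieBracket_add_right (V := Y) hZ hW
    simp only [leviCivitaKoszul, h1 hX, h1 hY, h3, h4]
    simp only [Pi.add_apply, map_add, add_apply]
    ring

theorem leviCivita_spec (g : Metric d M) {X Y : VField d M} {x : M}
    (hX : DiffVFieldAt X x) (hY : DiffVFieldAt Y x) {Z : VField d M} (hZ : DiffVFieldAt Z x) :
    2 * g.inner x (leviCivita g X Y x) (Z x) = leviCivitaKoszul g X Y Z x := by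
  -- The value chosen by `epsilon` is meaningful only once a witness exists: half the covector given
  -- by tensoriality, raised by `♯_g`.
  have hex : ∃ u : TangentSpace (𝓡 d) x, ∀ Z : VField d M, DiffVFieldAt Z x →
      2 * g.inner x u (Z x) = leviCivitaKoszul g X Y Z x := by
    have hT := tensorialAt_leviCivitaKoszul g hX hY
    refine ⟨sharp g x ((1 / 2 : ℝ) • TensorialAt.mkHom _ x hT), fun Z hZ => ?_⟩
    change 2 * flat g x (sharp g x _) (Z x) = _
    rw [flat_sharp, smul_apply, TensorialAt.mkHom_apply hT hZ, smul_eq_mul]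
    ring
  exact Classical.epsilon_spec hex Z hZ

theorem eq_of_inner_eq (g : Metric d M) {x : M} {u v : TangentSpace (𝓡 d) x}
    (h : ∀ w, g.inner x u w = g.inner x v w) : u = v := by
  have : flat g x u = flat g x v := ContinuousLinearMap.ext h
  rw [← sharp_flat g x u, this, sharp_flat]

/-- Adding the Koszul formulas for `(X, Y, Z)` and `(X, Z, Y)` leaves only `2 X·g(Y, Z)`. -/
theorem leviCivita_metric (g : Metric d M) {X Y Z : VField d M} {x : M}
    (hX : DiffVFieldAt X x) (hY : DiffVFieldAt Y x) (hZ : DiffVFieldAt Z x) :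
    dfun (fun y => g.inner y (Y y) (Z y)) x (X x) =
      g.inner x (leviCivita g X Y x) (Z x) + g.inner x (Y x) (leviCivita g X Z x) := by
  have h1 := leviCivita_spec g hX hY hZ
  have h2 := leviCivita_spec g hX hZ hY
  have h3 : (fun y => g.inner y (Z y) (Y y)) = fun y => g.inner y (Y y) (Z y) := by
    ext y
    exact g.symm y _ _
  have h4 : VectorField.mlieBracket (𝓡 d) Z Y x = -VectorField.mlieBracket (𝓡 d) Y Z x :=
    VectorField.mlieBracket_swap_apply
  rw [g.symm x (Y x)]
  simp only [leviCivitaKoszul, h3, h4, map_neg, neg_apply] at h1 h2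
  linarith

end LeviCivita

/-! ### Smoothness of `♯_g` and extension of tangent vectors -/

section Regularity

open Filter Set Topology

variable {d : ℕ} {M : Type*} [TopologicalSpace M]
  [ChartedSpace (EuclideanSpace ℝ (Fin d)) M] [IsManifold (𝓡 d) ∞ M]

/-- In bundle coordinates `♯_g` is the inverse of `♭_g`, and inversion is smooth at an invertible
operator. -/
theorem contMDiff_sharp (g : Metric d M) :
    ContMDiff (𝓡 d) ((𝓡 d).prod
      𝓘(ℝ, (EuclideanSpace ℝ (Fin d) →L[ℝ] ℝ) →L[ℝ] EuclideanSpace ℝ (Fin d))) ∞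
    (fun x => Bundle.TotalSpace.mk' ((EuclideanSpace ℝ (Fin d) →L[ℝ] ℝ) →L[ℝ]
      EuclideanSpace ℝ (Fin d))
      (E := fun x : M => (TangentSpace (𝓡 d) x →L[ℝ] ℝ) →L[ℝ] TangentSpace (𝓡 d) x)
      x (sharp g x)) := by
  intro x₀
  have h1 := ((contMDiffAt_hom_bundle _).1 (g.contMDiff x₀)).2
  refine (contMDiffAt_hom_bundle _).2 ⟨contMDiffAt_id, ?_⟩
  have hmem := FiberBundle.mem_baseSet_trivializationAt' (F := EuclideanSpace ℝ (Fin d))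
    (E := fun x : M => TangentSpace (𝓡 d) x) x₀
  have hmem' := FiberBundle.mem_baseSet_trivializationAt' (F := EuclideanSpace ℝ (Fin d) →L[ℝ] ℝ)
    (E := fun x : M => TangentSpace (𝓡 d) x →L[ℝ] ℝ) x₀
  have h2 : ContMDiffAt (𝓡 d)
      𝓘(ℝ, (EuclideanSpace ℝ (Fin d) →L[ℝ] ℝ) →L[ℝ] EuclideanSpace ℝ (Fin d)) ∞
      (ContinuousLinearMap.inverse ∘ (fun x : M => ContinuousLinearMap.inCoordinates
        (EuclideanSpace ℝ (Fin d)) (fun x : M => TangentSpace (𝓡 d) x)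
        (EuclideanSpace ℝ (Fin d) →L[ℝ] ℝ) (fun x : M => TangentSpace (𝓡 d) x →L[ℝ] ℝ)
        x₀ x x₀ x (flat g x))) x₀ := by
    refine ContMDiffAt.comp x₀ ?_ h1
    apply ContDiffAt.contMDiffAt
    apply ContinuousLinearMap.IsInvertible.contDiffAt_map_inverse
    rw [ContinuousLinearMap.inCoordinates_eq hmem hmem']
    exact ContinuousLinearMap.isInvertible_equiv.comp
      ((flat_isInvertible g x₀).comp ContinuousLinearMap.isInvertible_equiv)
  refine h2.congr_of_eventuallyEq ?_
  filter_upwards [(trivializationAt _ _ x₀).open_baseSet.mem_nhds hmem,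
    (trivializationAt _ _ x₀).open_baseSet.mem_nhds hmem'] with x hx hx'
  simp only [Function.comp_apply]
  rw [ContinuousLinearMap.inCoordinates_eq hx hx', ContinuousLinearMap.inCoordinates_eq hx' hx]
  simp only [ContinuousLinearMap.inverse_equiv_comp, ContinuousLinearMap.inverse_comp_equiv,
    ContinuousLinearEquiv.symm_symm, sharp]
  rfl

theorem SmoothVField.flat {g : Metric d M} {X : VField d M} (hX : SmoothVField X) :
    SmoothForm (fun y => flat g y (X y)) :=
  ContMDiff.clm_bundle_apply g.contMDiff hX

theorem DiffVFieldAt.flat {g : Metric d M} {X : VField d M} {x : M} (hX : DiffVFieldAt X x) :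
    DiffFormAt (fun y => flat g y (X y)) x :=
  MDifferentiableAt.clm_bundle_apply ((g.contMDiff x).mdifferentiableAt (by simp)) hX

theorem SmoothForm.sharp {g : Metric d M} {α : OneForm d M} (hα : SmoothForm α) :
    SmoothVField (fun y => sharp g y (α y)) :=
  ContMDiff.clm_bundle_apply (contMDiff_sharp g) hα

theorem DiffFormAt.sharp {g : Metric d M} {α : OneForm d M} {x : M} (hα : DiffFormAt α x) :
    DiffVFieldAt (fun y => sharp g y (α y)) x :=
  MDifferentiableAt.clm_bundle_apply ((contMDiff_sharp g x).mdifferentiableAt (by simp)) hα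

theorem SmoothVField.endApply {Φ : EndField d M} {X : VField d M} (hΦ : SmoothEnd Φ)
    (hX : SmoothVField X) : SmoothVField (fun y => Φ y (X y)) :=
  ContMDiff.clm_bundle_apply hΦ hX

theorem DiffVFieldAt.endApply {Φ : EndField d M} {X : VField d M} {x : M} (hΦ : SmoothEnd Φ)
    (hX : DiffVFieldAt X x) : DiffVFieldAt (fun y => Φ y (X y)) x :=
  MDifferentiableAt.clm_bundle_apply ((hΦ x).mdifferentiableAt (by simp)) hX

theorem SmoothForm.apply {η : OneForm d M} {X : VField d M} (hη : SmoothForm η)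
    (hX : SmoothVField X) : ContMDiff (𝓡 d) 𝓘(ℝ, ℝ) ∞ (fun y => η y (X y)) := by
  intro x
  have := ContMDiff.clm_bundle_apply (E₂ := Bundle.Trivial M ℝ) (F₂ := ℝ) hη hX x
  exact (Bundle.contMDiffAt_totalSpace.1 this).2

theorem DiffFormAt.apply {η : OneForm d M} {X : VField d M} {x : M} (hη : DiffFormAt η x)
    (hX : DiffVFieldAt X x) : MDifferentiableAt (𝓡 d) 𝓘(ℝ, ℝ) (fun y => η y (X y)) x := by
  have := MDifferentiableAt.clm_bundle_apply (E₂ := Bundle.Trivial M ℝ) (F₂ := ℝ) hη hX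
  exact ((mdifferentiableAt_totalSpace (𝓡 d) _).1 this).2

/-- A local extension is cut off by a bump function; Hausdorffness makes the extension by zero
smooth. Global fields are required because compatibility is tested on global smooth forms. -/
theorem exists_smoothVField [T2Space M] {x : M} (v : TangentSpace (𝓡 d) x) :
    ∃ X : VField d M, SmoothVField X ∧ X x = v := by
  obtain ⟨s, hs, hsX⟩ := FiberBundle.exists_contMDiffOn_extend (k := ∞) (𝓡 d)
    (EuclideanSpace ℝ (Fin d)) v
  obtain ⟨u, hus, hu, hxu⟩ := mem_nhds_iff.1 hs
  obtain ⟨f, -, hf⟩ := (SmoothBumpFunction.nhds_basis_tsupport (I := 𝓡 d) x).mem_iff.1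
    (hu.mem_nhds hxu)
  refine ⟨(f : M → ℝ) • FiberBundle.extend (EuclideanSpace ℝ (Fin d)) v, ?_, by simp⟩
  exact ContMDiffOn.smul_section_of_tsupport (u := u) f.contMDiff.contMDiffOn hu hf (hsX.mono hus)

end Regularity

/-! ### Pointwise algebra of a Riemannian contact structure -/

namespace IsRiemannianContact

variable {n : ℕ} {M : Type*} [TopologicalSpace M]
  [ChartedSpace (EuclideanSpace ℝ (Fin (2 * n + 1))) M] [IsManifold (𝓡 (2 * n + 1)) ∞ M]
  {η : OneForm (2 * n + 1) M} {g : Metric (2 * n + 1) M} {Φ : EndField (2 * n + 1) M}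

theorem inner_Φ_left (h : IsRiemannianContact η g Φ) (x : M)
    (v w : TangentSpace (𝓡 (2 * n + 1)) x) : g.inner x (Φ x v) w = -g.inner x v (Φ x w) := by
  rw [g.symm, h.inner_Φ, h.inner_Φ, dform_swap]

/-- `g(Φξ, Φξ) = -g(ξ, Φ²ξ) = 0` because `Φ²ξ = -ξ + η(ξ)ξ`, and `g` is definite. -/
theorem Φ_reeb (h : IsRiemannianContact η g Φ) (x : M) : Φ x (reeb η x) = 0 := by
  by_contra hne
  have h1 := g.pos x _ hne
  rw [h.inner_Φ_left, h.almostContact.Φ_sq, h.almostContact.η_ξ] at h1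
  simp at h1

theorem inner_reeb (h : IsRiemannianContact η g Φ) (x : M)
    (v : TangentSpace (𝓡 (2 * n + 1)) x) : g.inner x v (reeb η x) = η x v := by
  have h1 := h.almostContact.associated x v (reeb η x)
  rw [h.Φ_reeb, map_zero, h.almostContact.η_ξ] at h1
  linarith

theorem η_Φ (h : IsRiemannianContact η g Φ) (x : M)
    (v : TangentSpace (𝓡 (2 * n + 1)) x) : η x (Φ x v) = 0 := by
  rw [← h.inner_reeb, h.inner_Φ_left, h.Φ_reeb, map_zero, neg_zero]

theorem flatContact_eq (h : IsRiemannianContact η g Φ) (x : M)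
    (v : TangentSpace (𝓡 (2 * n + 1)) x) :
    flatContact η x v = flat g x (Φ x v + η x v • reeb η x) := by
  ext w
  change flatContact η x v w = g.inner x _ w
  rw [flatContact_apply, map_add, map_smul, add_apply, smul_apply, h.inner_Φ_left, h.inner_Φ,
    g.symm x (reeb η x), h.inner_reeb, smul_eq_mul]

/-- `-Φ + η ⊗ ξ` is a right inverse of `Φ + η ⊗ ξ`. -/
theorem Φ_add_inverse (h : IsRiemannianContact η g Φ) (x : M)
    (v : TangentSpace (𝓡 (2 * n + 1)) x) :
    Φ x (-Φ x v + η x v • reeb η x) + η x (-Φ x v + η x v • reeb η x) • reeb η x = v := by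
  simp only [map_add, map_neg, map_smul, h.Φ_reeb, h.almostContact.Φ_sq, h.η_Φ,
    h.almostContact.η_ξ]
  simp

theorem inverse_Φ_add (h : IsRiemannianContact η g Φ) (x : M)
    (v : TangentSpace (𝓡 (2 * n + 1)) x) :
    -Φ x (Φ x v + η x v • reeb η x) + η x (Φ x v + η x v • reeb η x) • reeb η x = v := by
  simp only [map_add, map_smul, h.Φ_reeb, h.almostContact.Φ_sq, h.η_Φ, h.almostContact.η_ξ]
  simp

/-- The factorisation `♭_η = ♭_g ∘ (Φ + η ⊗ ξ)` is inverted factor by factor. -/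
theorem sharpContact_eq (h : IsRiemannianContact η g Φ) (x : M)
    (α : Cotangent (2 * n + 1) x) :
    sharpContact η x α = -Φ x (sharp g x α) + η x (sharp g x α) • reeb η x := by
  have key : (flatContact η x).inverse = (-Φ x + (η x).smulRight (reeb η x)).comp (sharp g x) := by
    refine ContinuousLinearMap.inverse_eq ?_ ?_
    · ext1 β
      change flatContact η x (-Φ x (sharp g x β) + η x (sharp g x β) • reeb η x) = β
      rw [h.flatContact_eq, h.Φ_add_inverse, flat_sharp]
    · ext1 v
      change -Φ x (sharp g x (flatContact η x v)) + η x (sharp g x (flatContact η x v)) • reeb η x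
        = v
      rw [h.flatContact_eq, sharp_flat, h.inverse_Φ_add]
  rw [sharpContact, key]
  rfl

theorem flatContact_sharpContact (h : IsRiemannianContact η g Φ) (x : M)
    (α : Cotangent (2 * n + 1) x) : flatContact η x (sharpContact η x α) = α := by
  rw [h.sharpContact_eq, h.flatContact_eq, h.Φ_add_inverse, flat_sharp]

theorem sharpContact_flatContact (h : IsRiemannianContact η g Φ) (x : M)
    (v : TangentSpace (𝓡 (2 * n + 1)) x) : sharpContact η x (flatContact η x v) = v := by
  rw [h.sharpContact_eq, h.flatContact_eq, sharp_flat, h.inverse_Φ_add]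

theorem contactBivector_flatContact (h : IsRiemannianContact η g Φ) (x : M)
    (v w : TangentSpace (𝓡 (2 * n + 1)) x) :
    contactBivector η x (flatContact η x v) (flatContact η x w) = dform η x v w := by
  change dform η x (sharpContact η x _) (sharpContact η x _) = _
  rw [h.sharpContact_flatContact, h.sharpContact_flatContact]

theorem flatContact_reeb_apply (h : IsRiemannianContact η g Φ) (x : M)
    (v : TangentSpace (𝓡 (2 * n + 1)) x) : flatContact η x v (reeb η x) = η x v := by
  rw [flatContact_apply, ← h.inner_Φ, h.Φ_reeb, h.almostContact.η_ξ, map_zero]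
  ring

theorem flatContact_reeb (h : IsRiemannianContact η g Φ) (x : M) :
    flatContact η x (reeb η x) = η x := h.flatContact_sharpContact x (η x)

/-- `Φ` loses exactly `η(v) η(w)` from `g(v, w)`; the component along the unit vector `ξ`,
orthogonal to the image of `Φ`, restores it. -/
theorem cometric_flatContact (h : IsRiemannianContact η g Φ) (x : M)
    (v w : TangentSpace (𝓡 (2 * n + 1)) x) :
    cometric g x (flatContact η x v) (flatContact η x w) = g.inner x v w := by
  rw [cometric, h.flatContact_eq, h.flatContact_eq, sharp_flat, sharp_flat]
  simp only [map_add, map_smul, add_apply, smul_apply, h.inner_reeb, g.symm x (reeb η x),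
    h.almostContact.associated, h.η_Φ, h.almostContact.η_ξ, smul_eq_mul]
  ring

theorem sharpPi_flatContact (h : IsRiemannianContact η g Φ) (x : M)
    (v : TangentSpace (𝓡 (2 * n + 1)) x) :
    sharpPi (contactBivector η) x (flatContact η x v) = v - η x v • reeb η x := by
  refine eq_of_inner_eq g fun w => ?_
  rw [g.symm, g.symm x _ w]
  change flat g x w _ = flat g x w _
  -- The test covector is rewritten as `♭_η u`, on which `π` is `dη`.
  obtain ⟨u, hu⟩ : ∃ u, flatContact η x u = flat g x w := ⟨_, h.flatContact_sharpContact x _⟩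
  rw [← hu, apply_sharpPi, h.contactBivector_flatContact, map_sub, map_smul,
    h.flatContact_reeb_apply, flatContact_apply, dform_swap]
  simp only [smul_eq_mul]
  ring

theorem anchor_flatContact (h : IsRiemannianContact η g Φ) (x : M)
    (v : TangentSpace (𝓡 (2 * n + 1)) x) :
    anchor (contactBivector η) (reeb η) x (flatContact η x v) = v := by
  rw [anchor, h.sharpPi_flatContact, h.flatContact_reeb_apply, sub_add_cancel]

theorem flat_reeb (h : IsRiemannianContact η g Φ) (x : M) : flat g x (reeb η x) = η x := by
  ext v
  exact (g.symm x _ _).trans (h.inner_reeb x v)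

theorem lamForm_eq (h : IsRiemannianContact η g Φ) :
    lamForm (contactBivector η) (reeb η) g = η := by
  funext x
  have hJ : J (contactBivector η) g x (reeb η x) = 0 := by
    rw [J, h.flat_reeb, ← h.flatContact_reeb, h.sharpPi_flatContact, h.almostContact.η_ξ, one_smul,
      sub_self]
  rw [lamForm, hJ, h.inner_reeb, h.almostContact.η_ξ, h.flat_reeb, one_smul, map_zero, sub_zero]

/-- The image of `♯_π` lies in `ker η`, the orthogonal of `ξ`. This removes the two `J*` terms from
the compatibility condition. -/
theorem Jstar_reeb (h : IsRiemannianContact η g Φ) (x : M)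
    (v : TangentSpace (𝓡 (2 * n + 1)) x) :
    Jstar (contactBivector η) g x (flatContact η x v) (reeb η x) = 0 := by
  change g.inner x (sharpPi (contactBivector η) x (flatContact η x v)) (reeb η x) = 0
  rw [h.inner_reeb, h.sharpPi_flatContact, map_sub, map_smul, h.almostContact.η_ξ]
  simp

/-! ### Regularity of `♭_η` and `♯_η` -/

theorem smoothForm_flatContact (h : IsRiemannianContact η g Φ) {X : VField (2 * n + 1) M}
    (hX : SmoothVField X) : SmoothForm (fun y => flatContact η y (X y)) := by
  have h1 : SmoothVField (fun y => Φ y (X y) + η y (X y) • reeb η y) :=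
    (hX.endApply h.almostContact.smooth_Φ).add_section
      ((h.almostContact.smooth_η.apply hX).smul_section h.almostContact.smooth_ξ)
  simp only [h.flatContact_eq]
  exact h1.flat

theorem diffFormAt_flatContact (h : IsRiemannianContact η g Φ) {X : VField (2 * n + 1) M} {x : M}
    (hX : DiffVFieldAt X x) : DiffFormAt (fun y => flatContact η y (X y)) x := by
  have h1 : DiffVFieldAt (fun y => Φ y (X y) + η y (X y) • reeb η y) x :=
    mdifferentiableAt_add_section (hX.endApply h.almostContact.smooth_Φ)
      (((h.almostContact.smooth_η.diffFormAt x).apply hX).smul_section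
        (h.almostContact.smooth_ξ.diffVFieldAt x))
  simp only [h.flatContact_eq]
  exact h1.flat

theorem smoothVField_sharpContact (h : IsRiemannianContact η g Φ) {α : OneForm (2 * n + 1) M}
    (hα : SmoothForm α) : SmoothVField (fun y => sharpContact η y (α y)) := by
  have h1 := hα.sharp (g := g)
  simp only [h.sharpContact_eq]
  exact (h1.endApply h.almostContact.smooth_Φ).neg_section.add_section
    ((h.almostContact.smooth_η.apply h1).smul_section h.almostContact.smooth_ξ)

theorem diffVFieldAt_sharpContact (h : IsRiemannianContact η g Φ) {α : OneForm (2 * n + 1) M}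
    {x : M} (hα : DiffFormAt α x) : DiffVFieldAt (fun y => sharpContact η y (α y)) x := by
  have h1 := hα.sharp (g := g)
  simp only [h.sharpContact_eq]
  exact mdifferentiableAt_add_section
    (mdifferentiableAt_neg_section (h1.endApply h.almostContact.smooth_Φ))
    (((h.almostContact.smooth_η.diffFormAt x).apply h1).smul_section
      (h.almostContact.smooth_ξ.diffVFieldAt x))

end IsRiemannianContact

theorem dfun_neg {d : ℕ} {M : Type*} [TopologicalSpace M]
    [ChartedSpace (EuclideanSpace ℝ (Fin d)) M] (f : M → ℝ) (x : M) (v : TangentSpace (𝓡 d) x) :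
    dfun (fun y => -f y) x v = -dfun f x v := by
  simp [dfun, mvfderiv_fun_neg]

/-! ### Transport of bracket, connection and `Dπ` through `♭_η` -/

namespace IsRiemannianContact

variable {n : ℕ} {M : Type*} [TopologicalSpace M]
  [ChartedSpace (EuclideanSpace ℝ (Fin (2 * n + 1))) M] [IsManifold (𝓡 (2 * n + 1)) ∞ M]
  {η : OneForm (2 * n + 1) M} {g : Metric (2 * n + 1) M} {Φ : EndField (2 * n + 1) M}

/-- `♭_η` is an isomorphism from the Lie bracket of vector fields to the bracket
`[·,·]_{π,ξ}^g`. -/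
theorem metricBracket_flatContact (h : IsRiemannianContact η g Φ) {X Y : VField (2 * n + 1) M}
    {x : M} (hX : DiffVFieldAt X x) (hY : DiffVFieldAt Y x) :
    metricBracket (contactBivector η) (reeb η) g (fun y => flatContact η y (X y))
      (fun y => flatContact η y (Y y)) x =
      flatContact η x (VectorField.mlieBracket (𝓡 (2 * n + 1)) X Y x) := by
  have h1 : (fun y => flatContact η y (Y y)
      (sharpPi (contactBivector η) y (flatContact η y (X y)))) =
      fun y => dform η y (X y) (Y y) := by
    funext y
    rw [apply_sharpPi, h.contactBivector_flatContact]
  have h2 : (fun y => flatContact η y (X y)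
      (sharpPi (contactBivector η) y (flatContact η y (Y y)))) =
      fun y => -dform η y (X y) (Y y) := by
    funext y
    rw [apply_sharpPi, h.contactBivector_flatContact, dform_swap]
  ext w
  rw [flatContact_mlieBracket h.almostContact.smooth_η hX hY, metricBracket, h.lamForm_eq]
  simp only [jacobiBracket, koszulBracket, lieForm, h1, h2]
  -- Since `♯_π ♭_η X = X - η(X)ξ`, the Reeb parts of the Koszul bracket cancel the `i_ξ d` parts of
  -- the `L_ξ` terms.
  simp only [h.contactBivector_flatContact,
    h.flatContact_reeb_apply, h.sharpPi_flatContact, add_apply, sub_apply, smul_apply, map_sub,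
    map_smul, smul_eq_mul, dfun_neg]
  ring

theorem contraKoszul_flatContact (h : IsRiemannianContact η g Φ) {X Y Z : VField (2 * n + 1) M}
    {x : M} (hX : DiffVFieldAt X x) (hY : DiffVFieldAt Y x) (hZ : DiffVFieldAt Z x) :
    contraKoszul (contactBivector η) (reeb η) g (fun y => flatContact η y (X y))
      (fun y => flatContact η y (Y y)) (fun y => flatContact η y (Z y)) x =
      leviCivitaKoszul g X Y Z x := by
  simp only [contraKoszul, leviCivitaKoszul, h.metricBracket_flatContact hX hY,
    h.metricBracket_flatContact hX hZ, h.metricBracket_flatContact hY hZ, h.cometric_flatContact,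
    h.anchor_flatContact]

/-- `♭_η` carries the Levi-Civita connection of `g` to the contravariant Levi-Civita derivative of
`(π, ξ, g)`. -/
theorem contraDeriv_flatContact (h : IsRiemannianContact η g Φ) {X Y : VField (2 * n + 1) M}
    {x : M} (hX : DiffVFieldAt X x) (hY : DiffVFieldAt Y x) :
    contraDeriv (contactBivector η) (reeb η) g (fun y => flatContact η y (X y))
      (fun y => flatContact η y (Y y)) x = flatContact η x (leviCivita g X Y x) := by
  have hex : ∃ δ : Cotangent (2 * n + 1) x, ∀ γ : OneForm (2 * n + 1) M, DiffFormAt γ x →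
      2 * cometric g x δ (γ x) = contraKoszul (contactBivector η) (reeb η) g
        (fun y => flatContact η y (X y)) (fun y => flatContact η y (Y y)) γ x := by
    refine ⟨flatContact η x (leviCivita g X Y x), fun γ hγ => ?_⟩
    -- Every test form is `♭_η Z` with `Z = ♯_η γ`, so the Koszul formula for `∇` supplies the
    -- witness that `epsilon` needs.
    obtain ⟨Z, hZ, rfl⟩ : ∃ Z : VField (2 * n + 1) M, DiffVFieldAt Z x ∧
        (fun y => flatContact η y (Z y)) = γ :=
      ⟨_, h.diffVFieldAt_sharpContact hγ, funext fun y => h.flatContact_sharpContact y _⟩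
    rw [h.cometric_flatContact, leviCivita_spec g hX hY hZ, h.contraKoszul_flatContact hX hY hZ]
  have hspec := Classical.epsilon_spec hex
  rw [← h.flatContact_sharpContact x (contraDeriv _ _ _ _ _ x)]
  congr 1
  refine eq_of_inner_eq g fun w => ?_
  obtain ⟨Z, hZ, rfl⟩ := exists_diffVFieldAt w
  have h1 := hspec _ (h.diffFormAt_flatContact hZ)
  rw [h.contraKoszul_flatContact hX hY hZ, ← leviCivita_spec g hX hY hZ] at h1
  rw [← h.cometric_flatContact, h.flatContact_sharpContact]
  exact mul_left_cancel₀ two_ne_zero h1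

/-- `π(♭Y, ♭Z) = g(Y, ΦZ)` is differentiated by metric compatibility; the term in `∇_X Y` cancels.
-/
theorem contraDerivPi_flatContact (h : IsRiemannianContact η g Φ)
    {X Y Z : VField (2 * n + 1) M} {x : M} (hX : DiffVFieldAt X x) (hY : DiffVFieldAt Y x)
    (hZ : DiffVFieldAt Z x) :
    contraDerivPi (contactBivector η) (reeb η) g (fun y => flatContact η y (X y))
      (fun y => flatContact η y (Y y)) (fun y => flatContact η y (Z y)) x =
      g.inner x (Y x)
        (leviCivita g X (fun y => Φ y (Z y)) x - Φ x (leviCivita g X Z x)) := by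
  have h1 := leviCivita_metric g hX hY (hZ.endApply h.almostContact.smooth_Φ)
  simp only [contraDerivPi, h.contraDeriv_flatContact hX hY, h.contraDeriv_flatContact hX hZ,
    h.contactBivector_flatContact, h.anchor_flatContact, ← h.inner_Φ, h1, map_sub]
  ring

/-- At given vector fields `X`, `Z`, the `½`-Kenmotsu identity paired with `Y` is the
compatibility identity for the forms `♭_η X`, `♭_η Y`, `♭_η Z`. -/
theorem compatible_iff_inner_kenmotsu (h : IsRiemannianContact η g Φ)
    {X Y Z : VField (2 * n + 1) M} {x : M} (hX : DiffVFieldAt X x) (hY : DiffVFieldAt Y x)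
    (hZ : DiffVFieldAt Z x) (P : BivField (2 * n + 1) M) (hP : P = contactBivector η)
    (α β γ : OneForm (2 * n + 1) M) (hα : α = fun y => flatContact η y (X y))
    (hβ : β = fun y => flatContact η y (Y y)) (hγ : γ = fun y => flatContact η y (Z y)) :
    contraDerivPi P (reeb η) g α β γ x =
      (1 / 2 : ℝ) * (γ x (reeb η x) * P x (α x) (β x) - β x (reeb η x) * P x (α x) (γ x)
        - Jstar P g x (γ x) (reeb η x) * cometric g x (α x) (β x)
        + Jstar P g x (β x) (reeb η x) * cometric g x (α x) (γ x)) ↔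
    g.inner x (Y x) (leviCivita g X (fun y => Φ y (Z y)) x - Φ x (leviCivita g X Z x)) =
      g.inner x (Y x)
        ((1 / 2 : ℝ) • (g.inner x (Φ x (X x)) (Z x) • reeb η x - η x (Z x) • Φ x (X x))) := by
  subst hP hα hβ hγ
  rw [h.contraDerivPi_flatContact hX hY hZ]
  simp only [h.flatContact_reeb_apply, h.contactBivector_flatContact, h.Jstar_reeb, map_smul,
    smul_eq_mul]
  rw [map_sub (g.inner x (Y x)) (_ • _) (_ • _), map_smul, map_smul, h.inner_reeb, h.inner_Φ_left,
    h.inner_Φ x (X x) (Z x), h.inner_Φ x (Y x) (X x), dform_swap η x (Y x) (X x)]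
  simp only [smul_eq_mul]
  constructor <;> intro hh <;> rw [hh] <;> ring

end IsRiemannianContact

end JacobiRiemannian

end

/-! ### The equivalence -/

open JacobiRiemannian in
theorem mainTheorem1 (n : ℕ) (hn : 1 ≤ n) {M : Type*} [TopologicalSpace M] [T2Space M]
    [ChartedSpace (EuclideanSpace ℝ (Fin (2 * n + 1))) M]
    [IsManifold (𝓡 (2 * n + 1)) ∞ M]
    (η : OneForm (2 * n + 1) M) (g : Metric (2 * n + 1) M) (Φ : EndField (2 * n + 1) M)
    (h : IsRiemannianContact η g Φ) :
    Compatible (contactBivector η) (reeb η) g ↔ IsHalfKenmotsu Φ (reeb η) η g := by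
  constructor
  · intro hc
    refine ⟨h.almostContact, fun X Z hX hZ x => eq_of_inner_eq g fun w => ?_⟩
    -- The Kenmotsu identity is vectorial, so it is tested against an arbitrary `w`, extended to a
    -- global smooth field to yield an admissible form `♭_η Y`.
    obtain ⟨Y, hY, rfl⟩ := exists_smoothVField w
    rw [g.symm, g.symm x _ (Y x)]
    exact (h.compatible_iff_inner_kenmotsu (hX.diffVFieldAt x) (hY.diffVFieldAt x)
      (hZ.diffVFieldAt x) _ rfl _ _ _ rfl rfl rfl).1
      (hc _ _ _ (h.smoothForm_flatContact hX) (h.smoothForm_flatContact hY)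
        (h.smoothForm_flatContact hZ) x)
  · intro hk α β γ hα hβ hγ x
    have hX := h.smoothVField_sharpContact hα
    have hY := h.smoothVField_sharpContact hβ
    have hZ := h.smoothVField_sharpContact hγ
    -- Conversely, all smooth forms are reached, since `α = ♭_η(♯_η α)` with `♯_η α` smooth.
    refine (h.compatible_iff_inner_kenmotsu (hX.diffVFieldAt x) (hY.diffVFieldAt x)
      (hZ.diffVFieldAt x) _ rfl _ _ _ ?_ ?_ ?_).2 ?_
    · exact funext fun y => (h.flatContact_sharpContact y _).symm
    · exact funext fun y => (h.flatContact_sharpContact y _).symm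
    · exact funext fun y => (h.flatContact_sharpContact y _).symm
    · rw [hk.kenmotsu _ _ hX hZ x]
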